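/- Let $n\ge 1$ and let $q\in\mathbb C$ be nonzero and not a root of unity. Let $U_q^{+}$ and $U_q^{-}$ be the positive and negative parts of the quantized enveloping algebra of type $A_{2n-1}$, with generators $E_\alpha$, respectively $F_\alpha$, for the simple roots $\alpha$ of the Dynkin diagram $\nu_{n-1}-\dots-\nu_1-\beta-\mu_1-\dots-\mu_{n-1}$ (subject to the quantum Serre relations). Put $Z_{11}=E_\beta$, $Z_{i+1,1}=E_{\mu_i}Z_{i1}-q^{-1}Z_{i1}E_{\mu_i}$, $Z_{i,j+1}=E_{\nu_j}Z_{ij}-q^{-1}Z_{ij}E_{\nu_j}$ and $W_{11}=F_\beta$, $W_{i+1,1}=W_{i1}F_{\mu_i}-qF_{\mu_i}W_{i1}$, $W_{i,j+1}=W_{ij}F_{\nu_j}-qF_{\nu_j}W_{ij}$, and let $\mathcal A_q^{+}\subset U_q^{+}$ and $\mathcal A_q^{-}\subset U_q^{-}$ be the subalgebras generated by the $Z_{ij}$ and by the $W_{ij}$ $(1\le i,j\le n)$, respectively. The ordered monomials $Z^{\mathbf a}=Z_{11}^{a_{11}}Z_{21}^{a_{21}}\cdots Z_{n1}^{a_{n1}}Z_{12}^{a_{12}}\cdots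 Z_{nn}^{a_{nn}}$ and $W^{\mathbf a}$ (same order), $\mathbf a\in\mathbb N_0^{n^2}$, form bases of $\mathcal A_q^{+}$ and $\mathcal A_q^{-}$. Define linear operators on $\mathcal A_q^{+}$ by $M_{ij}Z^{\mathbf a}=Z^{\mathbf a+e_{ij}}$, $D_{ij}Z^{\mathbf a}=[a_{ij}]_q Z^{\mathbf a-e_{ij}}$ and $H_{ij}Z^{\mathbf a}=q^{a_{ij}}Z^{\mathbf a}$, where $[a]_q=q^{-a+1}+q^{-a+3}+\cdots+q^{a-1}$. For $X\in\{J,K,L\}$ let $(\cdot,\cdot)_X$ be the bilinear pairing of $\mathcal A_q^+$ and $\mathcal A_q^-$ with $$(Z^{\mathbf a},W^{\mathbf b})_X=\delta_{\mathbf a,\mathbf b}\Bigl(\frac{-1}{q-q^{-1}}\Bigr)^{|\mathbf a|}\prod_{i,j}\prod_{k=1}^{a_{ij}}[k]_X,$$ where $[k]_J=1+q^2+\cdots+q^{2k-2}$, $[k]_K=1+q^{-2}+\cdots+q^{-(2k-2)}$ and $[k]_L=[k]_q$. Then for all $i,j$ there is an operator $\left(\frac{\partial}{\partial Z_{ij}}\right)_X$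 on $\mathcal A_q^{+}$ dual to right multiplication by $W_{ij}$, i.e. $\bigl(\left(\tfrac{\partial}{\partial Z_{ij}}\right)_X u,v\bigr)_X=(u,vW_{ij})_X$ for all $u\in\mathcal A_q^+$, $v\in\mathcal A_q^-$. Let $\mathcal D(\partial_X,{}_ZM)$ (respectively $\mathcal D(\partial_X,M_Z)$) be the algebra of operators on $\mathcal A_q^{+}$ generated by all $\left(\frac{\partial}{\partial Z_{ij}}\right)_X$ together with all left multiplications $u\mapsto Z_{kl}u$ (respectively all right multiplications $u\mapsto uZ_{kl}$). In each of these six cases ($X=J,K,L$; left or right multiplications), for every index $(i,j)$ there are Laurent monomials $\psi_{ij}$ and $\phi_{ij}$ in the commuting operators $H_{st}$, $1\le s,t\le n$, whose exponents depend only on $n$, on the case and on $(i,j)$ (not on $q$), such that $$\psi_{ij}M_{ij}\quad\text{and}\quad \phi_{ij}D_{ij}$$ belong to the algebra of the given case. -/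

import Mathlib

noncomputable section

namespace QuantizedDiffOps

/-! ### The positive and negative parts of the quantized enveloping algebra of type `A_{2n-1}` -/

/-- The simple roots of type `A_{2n-1}`: the non-compact root `β` in the middle of the Dynkin
diagram, with the compact roots `μ_1, …, μ_{n-1}` on one side of it and `ν_1, …, ν_{n-1}` on the
other side.  Indices are counted from `0`: `mu k` is `μ_{k+1}` and `nu k` is `ν_{k+1}`. -/
inductive SimpleRoot (n : ℕ) : Type
  | beta : SimpleRoot n
  | mu (k : Fin (n - 1)) : SimpleRoot n
  | nu (k : Fin (n - 1)) : SimpleRoot n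

/-- The place of a simple root on the Dynkin diagram
`ν_{n-1} — … — ν_1 — β — μ_1 — … — μ_{n-1}`. -/
def SimpleRoot.pos {n : ℕ} : SimpleRoot n → ℤ
  | .beta => 0
  | .mu k => (k : ℤ) + 1
  | .nu k => -((k : ℤ) + 1)

/-- Two simple roots are adjacent when they are neighbours on the Dynkin diagram. -/
def SimpleRoot.Adjacent {n : ℕ} (a b : SimpleRoot n) : Prop := |a.pos - b.pos| = 1

/-- The quantum Serre relations of type `A_{2n-1}`. -/
inductive SerreRel (n : ℕ) (q : ℂ) :
    FreeAlgebra ℂ (SimpleRoot n) → FreeAlgebra ℂ (SimpleRoot n) → Prop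
  | comm (a b : SimpleRoot n) (h : ¬ a.Adjacent b) :
      SerreRel n q (FreeAlgebra.ι ℂ a * FreeAlgebra.ι ℂ b)
        (FreeAlgebra.ι ℂ b * FreeAlgebra.ι ℂ a)
  | serre (a b : SimpleRoot n) (h : a.Adjacent b) :
      SerreRel n q
        (FreeAlgebra.ι ℂ a * FreeAlgebra.ι ℂ a * FreeAlgebra.ι ℂ b
          + FreeAlgebra.ι ℂ b * FreeAlgebra.ι ℂ a * FreeAlgebra.ι ℂ a)
        ((q + q⁻¹) • (FreeAlgebra.ι ℂ a * FreeAlgebra.ι ℂ b * FreeAlgebra.ι ℂ a))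

/-- The algebra on one generator per simple root, subject to the quantum Serre relations. -/
abbrev SerreAlgebra (n : ℕ) (q : ℂ) : Type := RingQuot (SerreRel n q)

/-- `U_q^+`, generated by the `E_α`. -/
abbrev UqPlus (n : ℕ) (q : ℂ) : Type := SerreAlgebra n q

/-- `U_q^-`, generated by the `F_α`, which satisfy the same Serre relations as the `E_α`. -/
abbrev UqMinus (n : ℕ) (q : ℂ) : Type := SerreAlgebra n q

/-- The generator `E_α` of `U_q^+`. -/
def E {n : ℕ} (q : ℂ) (a : SimpleRoot n) : UqPlus n q :=
  RingQuot.mkAlgHom ℂ (SerreRel n q) (FreeAlgebra.ι ℂ a)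

/-- The generator `F_α` of `U_q^-`. -/
def F {n : ℕ} (q : ℂ) (a : SimpleRoot n) : UqMinus n q :=
  RingQuot.mkAlgHom ℂ (SerreRel n q) (FreeAlgebra.ι ℂ a)

/-! ### The root vectors `Z_{ij}`, `W_{ij}` and the quadratic algebras -/

/-- `Z_{i+1,1} = T_{μ_i} ⋯ T_{μ_1}(E_β)`, as an iterated `q`-commutator: each step is
`x ↦ ad(E_α)(x) = E_α x - q⁻¹ x E_α`. -/
def zCol {n : ℕ} (q : ℂ) : (i : ℕ) → i < n → UqPlus n q
  | 0, _ => E q .beta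
  | i + 1, h =>
      E q (.mu ⟨i, by omega⟩) * zCol q i (by omega)
        - q⁻¹ • (zCol q i (by omega) * E q (.mu ⟨i, by omega⟩))

/-- `Z_{i+1,j+1} = T_{ν_j} ⋯ T_{ν_1} T_{μ_i} ⋯ T_{μ_1}(E_β)`. -/
def zEntry {n : ℕ} (q : ℂ) (i : ℕ) (hi : i < n) : (j : ℕ) → j < n → UqPlus n q
  | 0, _ => zCol q i hi
  | j + 1, h =>
      E q (.nu ⟨j, by omega⟩) * zEntry q i hi j (by omega)
        - q⁻¹ • (zEntry q i hi j (by omega) * E q (.nu ⟨j, by omega⟩))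

/-- `W_{i+1,1} = T_{μ_i} ⋯ T_{μ_1}(F_β)`, as an iterated `q`-commutator, starting from
`T_α(F_γ) = F_γ F_α - q F_α F_γ`. -/
def wCol {n : ℕ} (q : ℂ) : (i : ℕ) → i < n → UqMinus n q
  | 0, _ => F q .beta
  | i + 1, h =>
      wCol q i (by omega) * F q (.mu ⟨i, by omega⟩)
        - q • (F q (.mu ⟨i, by omega⟩) * wCol q i (by omega))

/-- `W_{i+1,j+1} = T_{ν_j} ⋯ T_{ν_1} T_{μ_i} ⋯ T_{μ_1}(F_β)`. -/
def wEntry {n : ℕ} (q : ℂ) (i : ℕ) (hi : i < n) : (j : ℕ) → j < n → UqMinus n q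
  | 0, _ => wCol q i hi
  | j + 1, h =>
      wEntry q i hi j (by omega) * F q (.nu ⟨j, by omega⟩)
        - q • (F q (.nu ⟨j, by omega⟩) * wEntry q i hi j (by omega))

/-- The nodes `(i,j)`, with `i` and `j` counted from `0`. -/
abbrev Node (n : ℕ) : Type := Fin n × Fin n

/-- The quadratic algebra `𝒜_q^+`, the subalgebra of `U_q^+` generated by the `Z_{ij}`. -/
def APlus (n : ℕ) (q : ℂ) : Subalgebra ℂ (UqPlus n q) :=
  Algebra.adjoin ℂ (Set.range fun p : Node n => zEntry q p.1 p.1.isLt p.2 p.2.isLt)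

/-- The quadratic algebra `𝒜_q^-`, the subalgebra of `U_q^-` generated by the `W_{ij}`. -/
def AMinus (n : ℕ) (q : ℂ) : Subalgebra ℂ (UqMinus n q) :=
  Algebra.adjoin ℂ (Set.range fun p : Node n => wEntry q p.1 p.1.isLt p.2 p.2.isLt)

/-- `Z_{ij}` as an element of `𝒜_q^+`. -/
def Z {n : ℕ} (q : ℂ) (p : Node n) : APlus n q :=
  ⟨zEntry q p.1 p.1.isLt p.2 p.2.isLt, Algebra.subset_adjoin ⟨p, rfl⟩⟩

/-- `W_{ij}` as an element of `𝒜_q^-`. -/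
def W {n : ℕ} (q : ℂ) (p : Node n) : AMinus n q :=
  ⟨wEntry q p.1 p.1.isLt p.2 p.2.isLt, Algebra.subset_adjoin ⟨p, rfl⟩⟩

/-- The product of `x_{11}, x_{21}, …, x_{n1}, x_{12}, …, x_{n2}, …, x_{1n}, …, x_{nn}`,
in this order. -/
def orderedProd {n : ℕ} {R : Type*} [Monoid R] (x : Node n → R) : R :=
  ((List.finRange n).map fun j => ((List.finRange n).map fun i => x (i, j)).prod).prod

/-- The ordered monomial `Z^a`. -/
def ZPow {n : ℕ} (q : ℂ) (a : Node n → ℕ) : APlus n q := orderedProd fun p => Z q p ^ a p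

/-- The ordered monomial `W^a`. -/
def WPow {n : ℕ} (q : ℂ) (a : Node n → ℕ) : AMinus n q := orderedProd fun p => W q p ^ a p

/-! ### The operators `M°`, `D°`, `H°`, in a basis indexed by multi-exponents -/

/-- `[a]_q = q^{-a+1} + q^{-a+3} + ⋯ + q^{a-1}`. -/
def qInt (q : ℂ) (a : ℕ) : ℂ := ∑ k ∈ Finset.range a, q ^ (2 * (k : ℤ) + 1 - (a : ℤ))

section Operators

variable {n : ℕ} {V : Type*} [AddCommMonoid V] [Module ℂ V]

/-- `M°_{ij}` raises the exponent at the node `(i,j)` by one. -/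
def opM (b : Module.Basis (Node n → ℕ) ℂ V) (p : Node n) : Module.End ℂ V :=
  b.constr ℂ fun a => b (a + Pi.single p 1)

/-- `D°_{ij}` lowers the exponent `a_{ij}` by one and multiplies by `[a_{ij}]_q`. -/
def opD (q : ℂ) (b : Module.Basis (Node n → ℕ) ℂ V) (p : Node n) : Module.End ℂ V :=
  b.constr ℂ fun a => qInt q (a p) • b (a - Pi.single p 1)

/-- `H°_{ij}` multiplies by `q^{a_{ij}}`. -/
def opH (q : ℂ) (b : Module.Basis (Node n → ℕ) ℂ V) (p : Node n) : Module.End ℂ V :=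
  b.constr ℂ fun a => q ^ a p • b a

/-- The Laurent monomial `∏_{s,t} (H°_{st})^{e_{st}}` with exponents `e_{st} ∈ ℤ`. -/
def laurentH (q : ℂ) (b : Module.Basis (Node n → ℕ) ℂ V) (e : Node n → ℤ) : Module.End ℂ V :=
  b.constr ℂ fun a => q ^ (∑ p, e p * (a p : ℤ)) • b a

/-- The exponent vector with a single `1` at a node gives the operator `H°` at that node. -/
theorem laurentH_single (q : ℂ) (b : Module.Basis (Node n → ℕ) ℂ V) (p : Node n) :
    laurentH q b (Pi.single p 1) = opH q b p := by
  refine b.ext fun a => ?_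
  have h : ∑ r, (Pi.single p 1 : Node n → ℤ) r * (a r : ℤ) = (a p : ℤ) := by
    rw [Finset.sum_eq_single p]
    · simp
    · intro r _ hr
      simp [Pi.single_eq_of_ne hr]
    · simp
  simp only [laurentH, opH, Module.Basis.constr_basis]
  rw [h, zpow_natCast]

/-- The zero exponent vector gives the identity. -/
theorem laurentH_zero (q : ℂ) (b : Module.Basis (Node n → ℕ) ℂ V) :
    laurentH q b 0 = 1 := by
  refine b.ext fun a => ?_
  simp [laurentH, Module.Basis.constr_basis]

/-- Adding exponent vectors amounts to composing the operators; with the two preceding facts,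
`laurentH q b e` is the product of the operators `(H°_{st})^{e_{st}}`. -/
theorem laurentH_add (q : ℂ) (hq : q ≠ 0) (b : Module.Basis (Node n → ℕ) ℂ V)
    (e f : Node n → ℤ) :
    laurentH q b (e + f) = laurentH q b e * laurentH q b f := by
  refine b.ext fun a => ?_
  simp [laurentH, Module.Basis.constr_basis, add_mul, Finset.sum_add_distrib, zpow_add₀ hq,
    smul_smul, mul_comm]

end Operators

/-! ### The three pairings and the algebras of differential operators -/

/-- The labels of the three pairings. -/
inductive Pairing : Type
  | J
  | K
  | L

/-- The three quantizations of an integer: `[[a]]_q = 1 + q^2 + ⋯ + q^{2a-2}`,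
`{{a}}_q = 1 + q^{-2} + ⋯ + q^{-(2a-2)}` and `[a]_q`. -/
def Pairing.int (q : ℂ) : Pairing → ℕ → ℂ
  | .J, a => ∑ k ∈ Finset.range a, q ^ (2 * (k : ℤ))
  | .K, a => ∑ k ∈ Finset.range a, q ^ (-(2 * (k : ℤ)))
  | .L, a => qInt q a

/-- The corresponding factorials. -/
def Pairing.factorial (q : ℂ) (X : Pairing) (a : ℕ) : ℂ :=
  ∏ k ∈ Finset.range a, X.int q (k + 1)

/-- The bilinear form with `(Z^a, W^b)_X = δ_{ab} (-1/(q - q⁻¹))^{|a|} ∏ (a_{ij})!_X`. -/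
def pairing {n : ℕ} (q : ℂ) (X : Pairing)
    (bZ : Module.Basis (Node n → ℕ) ℂ (APlus n q))
    (bW : Module.Basis (Node n → ℕ) ℂ (AMinus n q)) :
    APlus n q →ₗ[ℂ] AMinus n q →ₗ[ℂ] ℂ :=
  bZ.constr ℂ fun a => bW.constr ℂ fun b =>
    if a = b then (-1 / (q - q⁻¹)) ^ (∑ p, a p) * ∏ p, X.factorial q (a p) else 0

/-- `T` is the dual, for the pairing `X`, of right multiplication by `W_{ij}` on `𝒜_q^-`, that is,
`T = (∂/∂Z_{ij})_X`. -/
def IsPartial {n : ℕ} (q : ℂ) (X : Pairing)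
    (bZ : Module.Basis (Node n → ℕ) ℂ (APlus n q))
    (bW : Module.Basis (Node n → ℕ) ℂ (AMinus n q))
    (p : Node n) (T : Module.End ℂ (APlus n q)) : Prop :=
  ∀ (u : APlus n q) (v : AMinus n q),
    pairing q X bZ bW (T u) v = pairing q X bZ bW u (v * W q p)

/-- Left or right. -/
inductive Side : Type
  | left
  | right

/-- Left multiplication `u ↦ Z_{ij} u` or right multiplication `u ↦ u Z_{ij}` on `𝒜_q^+`. -/
def mulZ {n : ℕ} (q : ℂ) : Side → Node n → Module.End ℂ (APlus n q)
  | .left, p => LinearMap.mulLeft ℂ (Z q p)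
  | .right, p => LinearMap.mulRight ℂ (Z q p)

/-- The algebra `𝒟(∂_X, {}_Z M)` (left) or `𝒟(∂_X, M_Z)` (right), generated by all
`(∂/∂Z_{ij})_X` and all left, respectively right, multiplications by the `Z_{kl}`. -/
def diffOps {n : ℕ} (q : ℂ) (X : Pairing) (s : Side)
    (bZ : Module.Basis (Node n → ℕ) ℂ (APlus n q))
    (bW : Module.Basis (Node n → ℕ) ℂ (AMinus n q)) :
    Subalgebra ℂ (Module.End ℂ (APlus n q)) :=
  Algebra.adjoin ℂ
    ({T | ∃ p : Node n, IsPartial q X bZ bW p T} ∪ Set.range (mulZ q s))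

end QuantizedDiffOps

end

/-!
The proof has three parts.

*Relations.* The `Z_{ij}` satisfy the relations of quantum `n × n` matrices
(`quantumMatrix_Z`). The `q`-commutator with a compact simple root vector carries one row (or
column) to the next, and by the Serre relations this root vector commutes with all other rows,
except that it `q`-commutes with the one just reached; so the relations spread from the first
`2 × 2` block to all others (`DoubleChain`). The `W_{ij}` are scalar multiples of
the `Z_{ij}`, both parts of the quantized enveloping algebra being the same algebra, and satisfy the
same relations. Straightening then shows that ordered monomials span. That they are independent
follows from a representation of `U_q^+` by `q`-difference operators (`rep`), in which
`E_β` multiplies by a coordinate and the other generators act by quantized moves between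
neighbouring rows or columns: applied to the vector `1`, the ordered monomial `Z^a` gives a nonzero
multiple of the basis vector with exponents `a` (`prod_raise`).

*Leading terms.* By straightening, left multiplication by `Z_{ij}` is a Laurent monomial in the
`H_{st}` times `M_{ij}`, plus terms that raise by one an exponent of column `j` above row `i`
(`QuantumMatrix.entry_mul_mon`). Reflection in the antidiagonal is an antiautomorphism of the
relations, so right multiplication by `Z_{ij}` or `W_{ij}` is a Laurent monomial times `M_{ij}`,
plus terms that raise by one an exponent of row `i` to the right of column `j`
(`QuantumMatrix.mon_mul_entry`). Transposing the latter with respect to the pairing,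
`∂/∂Z_{ij}` is a Laurent monomial times `D_{ij}`, plus terms that lower such an exponent by one
(`hasLead_partialZ`). The choice of the pairing affects only the Laurent monomial.

*Separation.* If `ψ M_p` and `φ D_p` lie in the algebra, then so do two Laurent monomials `H` and
`H' = H (H_p)^2`, as combinations of `ψ M_p φ D_p` and `φ D_p ψ M_p` (`laurentH_mem`). For an
operator `T` in the algebra, `H T H' - q^{-2ε} H' T H` then lies in the algebra as well; it no
longer has the terms of `T` that change the exponent at `p` by `ε`, while those that leave it
unchanged are only multiplied by a Laurent monomial and a nonzero constant (`HasLead.separate`). So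
the unwanted terms of the generators at `(i,j)` can be removed as soon as the result is known at the
nodes that they concern: from right to left in each row for right multiplications
(`hasM_and_hasD_right`), and from top to bottom, in each row from right to left, for left multiplications
(`hasM_and_hasD_left`). All exponents that occur are independent of `q`.
-/

noncomputable section

namespace QuantizedDiffOps

/-! ### Quadratic relations among iterated `q`-commutators -/

section Relations

variable {A : Type*} [Ring A] [Algebra ℂ A] {q : ℂ}

/-- The cubic `q`-Serre relation, quadratic in `x` and linear in `z`. -/
def Serre (q : ℂ) (x z : A) : Prop := x * x * z + z * x * x = (q + q⁻¹) • (x * z * x)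

/-- The `q`-commutator `x z - q⁻¹ z x`. -/
def qBr (q : ℂ) (x z : A) : A := x * z - q⁻¹ • (z * x)

theorem Serre.mul_qBr (hq : q ≠ 0) {x z : A} (h : Serre q x z) :
    x * qBr q x z = q • (qBr q x z * x) := by
  unfold Serre at h
  unfold qBr
  linear_combination (norm := skip) h
  simp only [mul_sub, sub_mul, smul_mul_assoc, mul_smul_comm, mul_assoc, smul_sub, smul_smul]
  match_scalars <;> field_simp <;> ring

theorem Serre.qBr_mul (hq : q ≠ 0) {x z : A} (h : Serre q z x) :
    qBr q x z * z = q • (z * qBr q x z) := by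
  unfold Serre at h
  unfold qBr
  linear_combination (norm := skip) h
  simp only [mul_sub, sub_mul, smul_mul_assoc, mul_smul_comm, mul_assoc, smul_sub, smul_smul]
  match_scalars <;> field_simp <;> ring

theorem commute_qBr {u x z : A} (hx : Commute u x) (hz : Commute u z) :
    Commute u (qBr q x z) := by
  unfold qBr
  exact (hx.mul_right hz).sub_right ((hz.mul_right hx).smul_right _)

/-- The Serre relation is linear in its second argument, so it survives a `q`-commutator with an
element commuting with the first argument. -/
theorem Serre.qBr_right {u x z : A} (h : Serre q u x) (hz : Commute u z) :
    Serre q u (qBr q x z) := by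
  unfold Serre at h
  unfold Serre qBr
  have e1 : z * u = u * z := hz.eq.symm
  have e2 : ∀ v, z * (u * v) = u * (z * v) := fun v => by rw [← mul_assoc, e1, mul_assoc]
  linear_combination (norm := skip) h * z - q⁻¹ • (z * h)
  simp only [mul_add, add_mul, mul_sub, sub_mul, smul_mul_assoc, mul_smul_comm, mul_assoc,
    smul_sub, smul_add, smul_smul, e1, e2]
  match_scalars <;> ring

theorem Serre.qBr_right' {u x z : A} (h : Serre q u z) (hx : Commute u x) :
    Serre q u (qBr q x z) := by
  unfold Serre at h
  unfold Serre qBr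
  have e1 : x * u = u * x := hx.eq.symm
  have e2 : ∀ v, x * (u * v) = u * (x * v) := fun v => by rw [← mul_assoc, e1, mul_assoc]
  linear_combination (norm := skip) x * h - q⁻¹ • (h * x)
  simp only [mul_add, add_mul, mul_sub, sub_mul, smul_mul_assoc, mul_smul_comm, mul_assoc,
    smul_sub, smul_add, smul_smul, e1, e2]
  match_scalars <;> ring

/-- In a chain `z — x — y`, the middle element commutes with the iterated `q`-commutator of all
three. -/
theorem commute_qBr_qBr (hq : q ≠ 0) (h2 : 1 + q ^ 2 ≠ 0) {x y z : A} (hyz : Commute y z)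
    (hxy : Serre q x y) (hxz : Serre q x z) :
    Commute x (qBr q y (qBr q x z)) := by
  have e1 : z * y = y * z := hyz.eq.symm
  have e2 : ∀ v, z * (y * v) = y * (z * v) := fun v => by rw [← mul_assoc, e1, mul_assoc]
  have key : (1 + q ^ 2) • (x * qBr q y (qBr q x z) - qBr q y (qBr q x z) * x) = 0 := by
    unfold Serre at hxy hxz
    unfold qBr
    linear_combination (norm := skip) (-q⁻¹) • (hxz * y) + q • (y * hxz) - q • (hxy * z)
      + q⁻¹ • (z * hxy)
    simp only [mul_add, add_mul, mul_sub, sub_mul, smul_mul_assoc, mul_smul_comm, mul_assoc,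
      smul_sub, smul_add, smul_smul, e1, e2]
    match_scalars <;> field_simp <;> ring
  exact sub_eq_zero.mp ((smul_eq_zero.mp key).resolve_left h2)

/-- A sequence obtained from `z 0` by successive `q`-commutators with the simple root vectors
`x 0, x 1, …` of a Dynkin diagram of type `A`, to which `z 0` is attached at `x 0`. -/
structure Chain (q : ℂ) (x z : ℕ → A) : Prop where
  succ : ∀ i, z (i + 1) = qBr q (x i) (z i)
  comm : ∀ i j, i + 1 < j → Commute (x i) (x j)
  serre : ∀ i, Serre q (x i) (x (i + 1))
  serre' : ∀ i, Serre q (x (i + 1)) (x i)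
  comm_zero : ∀ i, Commute (x (i + 1)) (z 0)
  serre_zero : Serre q (x 0) (z 0)

namespace Chain

variable {x z : ℕ → A}

theorem commute_of_lt (h : Chain q x z) {i k : ℕ} (hik : i < k) : Commute (x k) (z i) := by
  induction i with
  | zero => obtain ⟨k, rfl⟩ := Nat.exists_eq_succ_of_ne_zero hik.ne'; exact h.comm_zero k
  | succ i ih =>
    rw [h.succ]
    exact commute_qBr (h.comm i k hik).symm (ih (by omega))

theorem serre_self (h : Chain q x z) (k : ℕ) : Serre q (x k) (z k) := by
  cases k with
  | zero => exact h.serre_zero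
  | succ k =>
    rw [h.succ]
    exact (h.serre' k).qBr_right (h.commute_of_lt (Nat.lt_succ_self k))

theorem mul_succ (h : Chain q x z) (hq : q ≠ 0) (k : ℕ) :
    x k * z (k + 1) = q • (z (k + 1) * x k) := by
  rw [h.succ]
  exact (h.serre_self k).mul_qBr hq

theorem commute_of_gt (h : Chain q x z) (hq : q ≠ 0) (h2 : 1 + q ^ 2 ≠ 0) {i k : ℕ}
    (hik : k + 1 < i) : Commute (x k) (z i) := by
  induction i, hik using Nat.le_induction with
  | base =>
    rw [h.succ, h.succ]
    exact commute_qBr_qBr hq h2 (h.commute_of_lt (Nat.lt_succ_self k)) (h.serre k)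
      (h.serre_self k)
  | succ i hi ih =>
    rw [h.succ]
    exact commute_qBr (h.comm k i (by omega)) ih

theorem mul_self (h : Chain q x z) (k : ℕ) :
    x k * z k = z (k + 1) + q⁻¹ • (z k * x k) := by
  rw [h.succ, qBr]; abel

end Chain

/-- Raising one factor of a quadratic relation by a `q`-commutator that the other factors do not
see. -/
theorem qBr_mul_eq {x z u : A} (hu : Commute x u) : qBr q x z * u = qBr q x (z * u) := by
  have e := hu.eq
  unfold qBr
  rw [sub_mul, smul_mul_assoc, mul_assoc, mul_assoc, mul_assoc, e]

theorem mul_qBr_eq {x z u : A} (hu : Commute x u) : u * qBr q x z = qBr q x (u * z) := by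
  have e := hu.eq
  unfold qBr
  rw [mul_sub, mul_smul_comm, ← mul_assoc, ← mul_assoc, ← mul_assoc, e]

theorem qBr_smul {x z : A} (c : ℂ) : qBr q x (c • z) = c • qBr q x z := by
  unfold qBr
  rw [mul_smul_comm, smul_mul_assoc, smul_sub, smul_comm]

theorem qBr_add {x z w : A} : qBr q x (z + w) = qBr q x z + qBr q x w := by
  unfold qBr
  rw [mul_add, add_mul, smul_add]; abel

/-- Simple root vectors `e k`, `f l` and a matrix `z i j` of root vectors: `e k` leads from row `k`
to row `k + 1` and `f l` from column `l` to column `l + 1`. -/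
structure DoubleChain (q : ℂ) (e f : ℕ → A) (z : ℕ → ℕ → A) : Prop where
  row : ∀ j, Chain q e fun i => z i j
  col : ∀ i, Chain q f fun j => z i j
  serre_e : Serre q (z 0 0) (e 0)
  serre_f : Serre q (z 0 0) (f 0)

namespace DoubleChain

variable {e f : ℕ → A} {z : ℕ → ℕ → A}

theorem transpose (h : DoubleChain q e f z) : DoubleChain q f e fun i j => z j i :=
  ⟨h.col, h.row, h.serre_f, h.serre_e⟩

/-- Relations inside the first column. -/
theorem col_zero (h : DoubleChain q e f z) (hq : q ≠ 0) (h2 : 1 + q ^ 2 ≠ 0) {i s : ℕ}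
    (his : i < s) : z s 0 * z i 0 = q • (z i 0 * z s 0) := by
  have h0 : ∀ s, 0 < s → z s 0 * z 0 0 = q • (z 0 0 * z s 0) := by
    intro s hs
    induction s, hs using Nat.le_induction with
    | base => rw [(h.row 0).succ 0]; exact h.serre_e.qBr_mul hq
    | succ s hs ih =>
      have hc := (h.row 0).commute_of_lt (i := 0) (k := s) hs
      rw [(h.row 0).succ s, qBr_mul_eq hc, ih, qBr_smul, ← mul_qBr_eq hc]
  induction i with
  | zero => exact h0 s his
  | succ i ih =>
    have hc := (h.row 0).commute_of_gt hq h2 (i := s) (k := i) his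
    rw [(h.row 0).succ i, mul_qBr_eq hc, ih (by omega), qBr_smul, ← qBr_mul_eq hc]

/-- A relation of the first `2 × 2` block that involves both diagonals: the image under `f 0` of
the relation in the first column. -/
theorem base (h : DoubleChain q e f z) (hq : q ≠ 0) (h2 : 1 + q ^ 2 ≠ 0) :
    z 1 1 * z 0 0 = z 0 0 * z 1 1 + q • (z 0 1 * z 1 0) - q⁻¹ • (z 1 0 * z 0 1) := by
  have hc := h.col_zero hq h2 (i := 0) (s := 1) one_pos
  have f0 := (h.col 0).mul_self 0
  have f1 := (h.col 1).mul_self 0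
  simp only [zero_add] at f0 f1
  have e1 : ∀ v, f 0 * (z 0 0 * v) = (z 0 1 + q⁻¹ • (z 0 0 * f 0)) * v :=
    fun v => by rw [← mul_assoc, f0]
  have e2 : ∀ v, f 0 * (z 1 0 * v) = (z 1 1 + q⁻¹ • (z 1 0 * f 0)) * v :=
    fun v => by rw [← mul_assoc, f1]
  linear_combination (norm := skip) f 0 * hc - q⁻¹ • q⁻¹ • (hc * f 0)
  simp only [mul_smul_comm, smul_mul_assoc, mul_assoc, e1, e2, add_mul, f0, f1, mul_add, smul_add,
    smul_smul]
  match_scalars <;> field_simp <;> ring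

/-- The transposed relation has the same left-hand side, so the difference of the two shows that
the antidiagonal entries commute. -/
theorem base_anti (h : DoubleChain q e f z) (hq : q ≠ 0) (h2 : 1 + q ^ 2 ≠ 0) :
    Commute (z 0 1) (z 1 0) := by
  have h3 : (1 + q ^ 2) • (z 0 1 * z 1 0 - z 1 0 * z 0 1) = 0 := by
    linear_combination (norm := skip) q • (h.transpose.base hq h2) - q • (h.base hq h2)
    match_scalars <;> field_simp <;> ring
  exact sub_eq_zero.mp ((smul_eq_zero.mp h3).resolve_left h2)

theorem base_diag (h : DoubleChain q e f z) (hq : q ≠ 0) (h2 : 1 + q ^ 2 ≠ 0) :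
    z 1 1 * z 0 0 = z 0 0 * z 1 1 + (q - q⁻¹) • (z 0 1 * z 1 0) := by
  rw [h.base hq h2, (h.base_anti hq h2).eq]
  module

/-- Moving the lower row of a `2 × 2` block down and the upper row up to a given place. -/
theorem rows_induction (P : ℕ → ℕ → Prop) (h01 : P 0 1)
    (hs : ∀ i s, i < s → P i s → P i (s + 1))
    (hi : ∀ i s, i + 1 < s → P i s → P (i + 1) s) {i s : ℕ} (his : i < s) : P i s := by
  have h0 : ∀ s, 0 < s → P 0 s := by
    intro s h0s
    induction s, h0s using Nat.le_induction with
    | base => exact h01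
    | succ s h ih => exact hs 0 s h ih
  induction i with
  | zero => exact h0 s his
  | succ i ih => exact hi i s his (ih (by omega))

theorem anti_step (h : DoubleChain q e f z) (hq : q ≠ 0) (h2 : 1 + q ^ 2 ≠ 0) {j t : ℕ}
    (h01 : Commute (z 0 t) (z 1 j)) {i s : ℕ} (his : i < s) :
    Commute (z i t) (z s j) := by
  refine rows_induction (fun i s => Commute (z i t) (z s j)) h01 ?_ ?_ his
  · intro i s his ih
    have hc := (h.row t).commute_of_lt his
    have := (h.row j).succ s
    show z i t * z (s + 1) j = z (s + 1) j * z i t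
    rw [this, mul_qBr_eq hc, qBr_mul_eq hc, ih.eq]
  · intro i s his ih
    have hc := (h.row j).commute_of_gt hq h2 his
    have := (h.row t).succ i
    show z (i + 1) t * z s j = z s j * z (i + 1) t
    rw [this, mul_qBr_eq hc, qBr_mul_eq hc, ih.eq]

theorem anti (h : DoubleChain q e f z) (hq : q ≠ 0) (h2 : 1 + q ^ 2 ≠ 0) {i s j t : ℕ}
    (his : i < s) (hjt : j < t) : Commute (z i t) (z s j) :=
  h.anti_step hq h2 (h.transpose.anti_step hq h2 (h.base_anti hq h2).symm hjt).symm his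

theorem diag_step (h : DoubleChain q e f z) (hq : q ≠ 0) (h2 : 1 + q ^ 2 ≠ 0) {j t : ℕ}
    (h01 : z 1 t * z 0 j = z 0 j * z 1 t + (q - q⁻¹) • (z 0 t * z 1 j)) {i s : ℕ} (his : i < s) :
    z s t * z i j = z i j * z s t + (q - q⁻¹) • (z i t * z s j) := by
  refine rows_induction
    (fun i s => z s t * z i j = z i j * z s t + (q - q⁻¹) • (z i t * z s j)) h01 ?_ ?_ his
  · intro i s his ih
    have ht := (h.row t).commute_of_lt his
    have hj := (h.row j).commute_of_lt his
    have h1 := (h.row t).succ s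
    have h2 := (h.row j).succ s
    rw [h1, h2, qBr_mul_eq hj, mul_qBr_eq hj, mul_qBr_eq ht, ih, qBr_add, qBr_smul]
  · intro i s his ih
    have ht := (h.row t).commute_of_gt hq h2 his
    have hj := (h.row j).commute_of_gt hq h2 his
    have h1 := (h.row t).succ i
    have h2 := (h.row j).succ i
    rw [h1, h2, qBr_mul_eq hj, mul_qBr_eq ht, qBr_mul_eq ht, ih, qBr_add, qBr_smul]

theorem diag (h : DoubleChain q e f z) (hq : q ≠ 0) (h2 : 1 + q ^ 2 ≠ 0) {i s j t : ℕ}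
    (his : i < s) (hjt : j < t) :
    z s t * z i j = z i j * z s t + (q - q⁻¹) • (z i t * z s j) := by
  refine h.diag_step hq h2 ?_ his
  have := h.transpose.diag_step hq h2 (j := 0) (t := 1)
    (by simpa only [(h.base_anti hq h2).eq] using h.base_diag hq h2) hjt
  simpa only [(h.anti hq h2 one_pos hjt).eq] using this

/-- Relations inside a column; beyond the first column they are the image of the commutation of
antidiagonal entries under `f j`. -/
theorem col_rel (h : DoubleChain q e f z) (hq : q ≠ 0) (h2 : 1 + q ^ 2 ≠ 0) {i s : ℕ} (j : ℕ)
    (his : i < s) : z s j * z i j = q • (z i j * z s j) := by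
  cases j with
  | zero => exact h.col_zero hq h2 his
  | succ j =>
    have ha := (h.anti hq h2 his (Nat.lt_succ_self j)).eq
    have fs := (h.col s).mul_self j
    have fi := (h.col i).mul_succ hq j
    simp only [Nat.succ_eq_add_one] at fs fi ha
    have e1 : ∀ v, f j * (z s j * v) = (z s (j + 1) + q⁻¹ • (z s j * f j)) * v :=
      fun v => by rw [← mul_assoc, fs]
    have e2 : ∀ v, f j * (z i (j + 1) * v) = q • (z i (j + 1) * (f j * v)) :=
      fun v => by rw [← mul_assoc, fi, smul_mul_assoc, mul_assoc]
    linear_combination (norm := skip) ha * f j - f j * ha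
    simp only [mul_smul_comm, smul_mul_assoc, mul_assoc, e1, e2, fs, fi, add_mul, mul_add,
      smul_add, smul_smul]
    match_scalars <;> field_simp <;> ring

theorem row_rel (h : DoubleChain q e f z) (hq : q ≠ 0) (h2 : 1 + q ^ 2 ≠ 0) (i : ℕ) {j t : ℕ}
    (hjt : j < t) : z i t * z i j = q • (z i j * z i t) :=
  h.transpose.col_rel hq h2 i hjt

end DoubleChain

end Relations

/-! ### Multiplication of ordered monomials in quantum matrices -/

section QuantumMatrix

variable {A : Type*} [Ring A] {q : ℂ} {n : ℕ}

/-- The ordered monomial with exponents `a`. -/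
def mon (x : Node n → A) (a : Node n → ℕ) : A := orderedProd fun p => x p ^ a p

/-- The part of an ordered monomial that lies in column `j`. -/
def colMon (x : Node n → A) (a : Node n → ℕ) (j : Fin n) : A :=
  ((List.finRange n).map fun i => x (i, j) ^ a (i, j)).prod

/-- The part of an ordered monomial that lies in the columns of a list. -/
def colsMon (x : Node n → A) (l : List (Fin n)) (a : Node n → ℕ) : A :=
  (l.map (colMon x a)).prod

theorem mon_eq_colsMon (x : Node n → A) (a : Node n → ℕ) :
    mon x a = colsMon x (List.finRange n) a := rfl

theorem colMon_congr (x : Node n → A) {a b : Node n → ℕ} {j : Fin n}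
    (h : ∀ i, a (i, j) = b (i, j)) : colMon x a j = colMon x b j := by
  simp [colMon, h]

theorem colsMon_congr (x : Node n → A) {a b : Node n → ℕ} {l : List (Fin n)}
    (h : ∀ j ∈ l, ∀ i, a (i, j) = b (i, j)) : colsMon x l a = colsMon x l b := by
  unfold colsMon
  congr 1
  exact List.map_congr_left fun j hj => colMon_congr x (h j hj)

theorem colsMon_append (x : Node n → A) (a : Node n → ℕ) (l l' : List (Fin n)) :
    colsMon x (l ++ l') a = colsMon x l a * colsMon x l' a := by
  simp [colsMon]

theorem colsMon_cons (x : Node n → A) (a : Node n → ℕ) (j : Fin n) (l : List (Fin n)) :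
    colsMon x (j :: l) a = colMon x a j * colsMon x l a := by
  simp [colsMon]

theorem colMon_zero (x : Node n → A) (j : Fin n) : colMon x 0 j = 1 := by
  simp [colMon]

theorem colsMon_zero (x : Node n → A) (l : List (Fin n)) : colsMon x l 0 = 1 := by
  unfold colsMon
  rw [List.map_congr_left (g := fun _ => 1) fun j _ => colMon_zero x j]
  simp

theorem finRange_split (j : Fin n) : ∃ l₁ l₂ : List (Fin n), List.finRange n = l₁ ++ j :: l₂ ∧
    l₁.Pairwise (· < ·) ∧ (∀ t ∈ l₁, t < j) ∧ ∀ t ∈ l₂, j < t := by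
  obtain ⟨l₁, l₂, h⟩ := List.append_of_mem (List.mem_finRange j)
  have hp : (List.finRange n).Pairwise (· < ·) := List.pairwise_lt_finRange n
  rw [h, List.pairwise_append, List.pairwise_cons] at hp
  exact ⟨l₁, l₂, h, hp.1, fun t ht => hp.2.2 t ht j (by simp), fun t ht => hp.2.1.1 t ht⟩

theorem sum_of_split {j : Fin n} {l₁ l₂ : List (Fin n)} (h : List.finRange n = l₁ ++ j :: l₂)
    (h₁ : ∀ t ∈ l₁, t < j) (h₂ : ∀ t ∈ l₂, j < t) (f : Fin n → ℕ) :
    ∑ t, (if t < j then f t else 0) = (l₁.map f).sum := by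
  rw [Fin.sum_univ_def, h, List.map_append, List.map_cons, List.sum_append, List.sum_cons,
    if_neg (lt_irrefl j), List.map_congr_left (g := f) fun t ht => if_pos (h₁ t ht),
    List.map_congr_left (g := fun _ => 0) fun t ht => if_neg (h₂ t ht).not_gt]
  simp

variable [Algebra ℂ A]

theorem mul_mem_of_mem_span {S : Set A} {N : Submodule ℂ A} {v w : A} (h : ∀ u ∈ S, u * w ∈ N)
    (hv : v ∈ Submodule.span ℂ S) : v * w ∈ N :=
  (Submodule.span_le (p := N.comap (LinearMap.mulRight ℂ w))).mpr h hv

theorem mul_mem_of_mem_span' {S : Set A} {N : Submodule ℂ A} {v w : A} (h : ∀ u ∈ S, w * u ∈ N)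
    (hv : v ∈ Submodule.span ℂ S) : w * v ∈ N :=
  (Submodule.span_le (p := N.comap (LinearMap.mulLeft ℂ w))).mpr h hv

/-- The defining relations of the algebra of quantum `n × n` matrices. -/
structure QuantumMatrix (q : ℂ) (x : Node n → A) : Prop where
  col : ∀ {i s : Fin n} (j : Fin n), i < s → x (s, j) * x (i, j) = q • (x (i, j) * x (s, j))
  row : ∀ (i : Fin n) {j t : Fin n}, j < t → x (i, t) * x (i, j) = q • (x (i, j) * x (i, t))
  anti : ∀ {i s j t : Fin n}, i < s → j < t → Commute (x (i, t)) (x (s, j))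
  diag : ∀ {i s j t : Fin n}, i < s → j < t →
    x (s, t) * x (i, j) = x (i, j) * x (s, t) + (q - q⁻¹) • (x (i, t) * x (s, j))

/-- The subalgebra generated by the entries in the columns of a list. -/
def colsAlg (x : Node n → A) (l : List (Fin n)) : Subalgebra ℂ A :=
  Algebra.adjoin ℂ (x '' {p | p.2 ∈ l})

theorem mem_colsAlg (x : Node n → A) {l : List (Fin n)} {p : Node n} (hp : p.2 ∈ l) :
    x p ∈ colsAlg x l :=
  Algebra.subset_adjoin ⟨p, hp, rfl⟩

namespace QuantumMatrix

variable {x : Node n → A}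

/-- An entry multiplies a column monomial of its own column, up to a power of `q`, by raising an
exponent. -/
theorem mul_colMon (h : QuantumMatrix q x) (s j : Fin n) (a : Node n → ℕ) :
    x (s, j) * colMon x a j
      = q ^ (∑ i, if i < s then a (i, j) else 0) • colMon x (a + Pi.single (s, j) 1) j := by
  obtain ⟨l₁, l₂, hl, -, h₁, h₂⟩ := finRange_split s
  have pass : ∀ l : List (Fin n), (∀ t ∈ l, t < s) →
      x (s, j) * (l.map fun i => x (i, j) ^ a (i, j)).prod
        = q ^ (l.map fun i => a (i, j)).sum •
          ((l.map fun i => x (i, j) ^ a (i, j)).prod * x (s, j)) := by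
    intro l hs
    induction l with
    | nil => simp
    | cons t l ih =>
      have hp : ∀ m : ℕ, x (s, j) * x (t, j) ^ m = q ^ m • (x (t, j) ^ m * x (s, j)) := by
        intro m
        induction m with
        | zero => simp
        | succ m ihm =>
          rw [pow_succ, ← mul_assoc, ihm, smul_mul_assoc, mul_assoc, h.col j (hs t (by simp)),
            mul_smul_comm, smul_smul, mul_assoc, pow_succ]
      rw [List.map_cons, List.prod_cons, ← mul_assoc, hp, smul_mul_assoc, mul_assoc,
        ih fun u hu => hs u (by simp [hu]), mul_smul_comm, smul_smul, List.map_cons, List.sum_cons,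
        pow_add, mul_assoc]
  have same : ∀ l : List (Fin n), (∀ t ∈ l, t ≠ s) →
      l.map (fun i => x (i, j) ^ (a + Pi.single (s, j) 1 : Node n → ℕ) (i, j))
        = l.map fun i => x (i, j) ^ a (i, j) := by
    intro l hl
    refine List.map_congr_left fun t ht => ?_
    have : (t, j) ≠ (s, j) := fun e => hl t ht (Prod.ext_iff.mp e).1
    simp [Pi.single_eq_of_ne this]
  rw [sum_of_split hl h₁ h₂]
  unfold colMon
  rw [hl, List.map_append, List.map_append, List.map_cons, List.map_cons, List.prod_append,
    List.prod_append, List.prod_cons, List.prod_cons, ← mul_assoc, pass l₁ h₁,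
    same l₁ fun t ht => (h₁ t ht).ne, same l₂ fun t ht => (h₂ t ht).ne', smul_mul_assoc, mul_assoc,
    ← mul_assoc (x (s, j)), ← pow_succ']
  simp

/-- The span of the products `u x_{sj}` with `s < i` and `u` in a given subalgebra. -/
def lower (x : Node n → A) (B : Subalgebra ℂ A) (i j : Fin n) : Submodule ℂ A :=
  Submodule.span ℂ {v | ∃ s < i, ∃ u ∈ B, v = u * x (s, j)}

theorem mul_mem_lower {B : Subalgebra ℂ A} {i j : Fin n} {u v : A} (hu : u ∈ B)
    (hv : v ∈ lower x B i j) : u * v ∈ lower x B i j := by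
  refine mul_mem_of_mem_span' ?_ hv
  rintro _ ⟨s, hs, w, hw, rfl⟩
  rw [← mul_assoc]
  exact Submodule.subset_span ⟨s, hs, _, B.mul_mem hu hw, rfl⟩

theorem lower_mono {B : Subalgebra ℂ A} {i s j : Fin n} (h : s ≤ i) :
    lower x B s j ≤ lower x B i j :=
  Submodule.span_mono fun _ ⟨t, ht, h'⟩ => ⟨t, ht.trans_le h, h'⟩

/-- Every entry `x_{ij}` of column `j` can be moved past `y`, with the factor `q ^ m i`, up to terms
ending in an entry of column `j` above it. -/
def Passes (q : ℂ) (x : Node n → A) (B : Subalgebra ℂ A) (j : Fin n) (y : A) (m : Fin n → ℕ) :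
    Prop :=
  y ∈ B ∧ ∀ i, x (i, j) * y - q ^ m i • (y * x (i, j)) ∈ lower x B i j

theorem Passes.one (B : Subalgebra ℂ A) (j : Fin n) : Passes q x B j 1 0 :=
  ⟨B.one_mem, fun i => by simp⟩

theorem Passes.mul {B : Subalgebra ℂ A} {j : Fin n} {y y' : A} {m m' : Fin n → ℕ}
    (h : Passes q x B j y m) (h' : Passes q x B j y' m') :
    Passes q x B j (y * y') (m + m') := by
  refine ⟨B.mul_mem h.1 h'.1, fun i => ?_⟩
  have aux : ∀ v ∈ lower x B i j, v * y' ∈ lower x B i j := by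
    intro v hv
    refine mul_mem_of_mem_span ?_ hv
    rintro _ ⟨s, hs, w, hw, rfl⟩
    rw [mul_assoc]
    refine mul_mem_lower hw ?_
    have h1 := lower_mono hs.le (h'.2 s)
    rw [← sub_add_cancel (x (s, j) * y') (q ^ m' s • (y' * x (s, j)))]
    exact add_mem h1 (Submodule.smul_mem _ _ (Submodule.subset_span ⟨s, hs, _, h'.1, rfl⟩))
  have e : x (i, j) * (y * y') - q ^ (m + m') i • (y * y' * x (i, j))
      = (x (i, j) * y - q ^ m i • (y * x (i, j))) * y'
        + q ^ m i • (y * (x (i, j) * y' - q ^ m' i • (y' * x (i, j)))) := by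
    simp only [sub_mul, mul_sub, smul_sub, smul_smul, smul_mul_assoc, mul_smul_comm, mul_assoc,
      Pi.add_apply, pow_add]
    abel
  rw [e]
  exact add_mem (aux _ (h.2 i)) (Submodule.smul_mem _ _ (mul_mem_lower h.1 (h'.2 i)))

theorem Passes.pow {B : Subalgebra ℂ A} {j : Fin n} {y : A} {m : Fin n → ℕ}
    (h : Passes q x B j y m) (k : ℕ) : Passes q x B j (y ^ k) (k • m) := by
  induction k with
  | zero => simpa using Passes.one B j
  | succ k ih =>
    rw [pow_succ, succ_nsmul]
    exact ih.mul h

theorem Passes.list_prod {B : Subalgebra ℂ A} {j : Fin n} {ι : Type*} (l : List ι) {y : ι → A}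
    {m : ι → Fin n → ℕ} (h : ∀ t ∈ l, Passes q x B j (y t) (m t)) :
    Passes q x B j (l.map y).prod (l.map m).sum := by
  induction l with
  | nil => simpa using Passes.one B j
  | cons t l ih =>
    rw [List.map_cons, List.map_cons, List.prod_cons, List.sum_cons]
    exact (h t (by simp)).mul (ih fun u hu => h u (by simp [hu]))

theorem passes_entry (h : QuantumMatrix q x) {l : List (Fin n)} {j : Fin n} {p : Node n}
    (hp : p.2 ∈ l) (hj : p.2 < j) :
    Passes q x (colsAlg x l) j (x p) (Pi.single p.1 1) := by
  obtain ⟨s, t⟩ := p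
  refine ⟨mem_colsAlg x hp, fun i => ?_⟩
  rcases lt_trichotomy i s with his | rfl | his
  · rw [(h.anti his hj).eq]
    simp [Pi.single_eq_of_ne his.ne]
  · rw [h.row i hj]
    simp
  · rw [h.diag his hj, (h.anti his hj).eq]
    simp only [Pi.single_eq_of_ne his.ne', pow_zero, one_smul, add_sub_cancel_left]
    exact Submodule.smul_mem _ _
      (Submodule.subset_span ⟨s, his, _, mem_colsAlg x (p := (i, t)) hp, rfl⟩)

theorem passes_colsMon (h : QuantumMatrix q x) {l : List (Fin n)} {j : Fin n}
    (hl : ∀ t ∈ l, t < j) (a : Node n → ℕ) :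
    Passes q x (colsAlg x l) j (colsMon x l a) fun i => (l.map fun t => a (i, t)).sum := by
  have h1 : ∀ t ∈ l, Passes q x (colsAlg x l) j (colMon x a t) fun i => a (i, t) := by
    intro t ht
    have := Passes.list_prod (List.finRange n) (y := fun i => x (i, t) ^ a (i, t))
      fun i _ => (h.passes_entry (p := (i, t)) ht (hl t ht)).pow (a (i, t))
    have e : ((List.finRange n).map fun i => a (i, t) • (Pi.single i 1 : Fin n → ℕ)).sum
        = fun i => a (i, t) := by
      rw [← Fin.sum_univ_def]
      funext i
      simp [Finset.sum_apply, Pi.single_apply]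
    rwa [e] at this
  have e : (l.map fun t i => a (i, t)).sum = fun i => (l.map fun t => a (i, t)).sum := by
    clear h1 hl
    induction l with
    | nil => rfl
    | cons t l ih =>
      funext i
      simp [ih]
  have := Passes.list_prod l h1
  rwa [e] at this

/-- Ordered monomials in some columns span the subalgebra generated by these columns. -/
theorem colsAlg_le_span (h : QuantumMatrix q x) (l : List (Fin n)) (hl : l.Pairwise (· < ·)) :
    Subalgebra.toSubmodule (colsAlg x l) ≤ Submodule.span ℂ (Set.range (colsMon x l)) := by
  induction l using List.reverseRecOn with
  | nil =>
    intro v hv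
    have : v ∈ (⊥ : Subalgebra ℂ A) := by simpa [colsAlg] using hv
    obtain ⟨c, rfl⟩ := Algebra.mem_bot.mp this
    rw [Algebra.algebraMap_eq_smul_one]
    exact Submodule.smul_mem _ _ (Submodule.subset_span ⟨0, by simp [colsMon]⟩)
  | append_singleton l j ih =>
    rw [List.pairwise_append] at hl
    have hlj : ∀ t ∈ l, t < j := fun t ht => hl.2.2 t ht j (by simp)
    have ih := ih hl.1
    set N := Submodule.span ℂ (Set.range (colsMon x (l ++ [j]))) with hN
    -- a prefix from the subalgebra can be combined with any monomial of the last column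
    have comb : ∀ u ∈ colsAlg x l, ∀ a, u * colMon x a j ∈ N := by
      intro u hu a
      refine mul_mem_of_mem_span ?_ (ih hu)
      rintro _ ⟨b, rfl⟩
      refine Submodule.subset_span ⟨fun p => if p.2 = j then a p else b p, ?_⟩
      rw [colsMon_append]
      congr 1
      · exact colsMon_congr x fun t ht i => if_neg (hlj t ht).ne
      · simpa [colsMon] using colMon_congr x fun i => if_pos rfl
    have low : ∀ i, ∀ v ∈ lower x (colsAlg x l) i j, ∀ a, v * colMon x a j ∈ N := by
      intro i v hv a
      refine mul_mem_of_mem_span ?_ hv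
      rintro _ ⟨s, hs, w, hw, rfl⟩
      rw [mul_assoc, h.mul_colMon, mul_smul_comm]
      exact Submodule.smul_mem _ _ (comb w hw _)
    have closed : ∀ p : Node n, p.2 ∈ l ++ [j] → ∀ v ∈ N, x p * v ∈ N := by
      intro p hp v hv
      refine mul_mem_of_mem_span' ?_ hv
      rintro _ ⟨a, rfl⟩
      have ha : colsMon x [j] a = colMon x a j := by simp [colsMon]
      rw [colsMon_append, ha, ← mul_assoc]
      have hP := h.passes_colsMon hlj a
      rcases List.mem_append.mp hp with hp | hp
      · exact comb _ (Subalgebra.mul_mem _ (mem_colsAlg x hp) hP.1) a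
      · obtain ⟨i, t⟩ := p
        obtain rfl : t = j := by simpa using hp
        rw [← sub_add_cancel (x (i, t) * colsMon x l a)
          (q ^ (l.map fun t => a (i, t)).sum • (colsMon x l a * x (i, t))), add_mul]
        refine add_mem (low i _ (hP.2 i) a) ?_
        rw [smul_mul_assoc, mul_assoc, h.mul_colMon, mul_smul_comm]
        exact Submodule.smul_mem _ _ (Submodule.smul_mem _ _ (comb _ hP.1 _))
    have closed' : ∀ u ∈ colsAlg x (l ++ [j]), ∀ v ∈ N, u * v ∈ N := by
      intro u hu
      refine Algebra.adjoin_induction (p := fun u _ => ∀ v ∈ N, u * v ∈ N) ?_ ?_ ?_ ?_ hu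
      · rintro _ ⟨p, hp, rfl⟩
        exact closed p hp
      · intro c v hv
        rw [← Algebra.smul_def]
        exact Submodule.smul_mem _ _ hv
      · intro u w _ _ h1 h2 v hv
        rw [add_mul]
        exact add_mem (h1 v hv) (h2 v hv)
      · intro u w _ _ h1 h2 v hv
        rw [mul_assoc]
        exact h1 _ (h2 v hv)
    intro u hu
    have := closed' u hu 1 (Submodule.subset_span ⟨0, colsMon_zero x _⟩)
    rwa [mul_one] at this

theorem adjoin_le_span (h : QuantumMatrix q x) :
    Subalgebra.toSubmodule (Algebra.adjoin ℂ (Set.range x))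
      ≤ Submodule.span ℂ (Set.range (mon x)) := by
  have := h.colsAlg_le_span (List.finRange n) (List.pairwise_lt_finRange n)
  have e : {p : Node n | p.2 ∈ List.finRange n} = Set.univ := by ext; simp
  rwa [colsAlg, e, Set.image_univ] at this

end QuantumMatrix

/-- The exponents of the power of `q` that appears when `x_{ij}` is moved from the left to its
place in an ordered monomial: `1` at the nodes to the left of `(i,j)` in its row and above it in
its column. -/
def leftExp (i j : Fin n) (p : Node n) : ℤ :=
  (if p.1 = i ∧ p.2 < j then 1 else 0) + if p.2 = j ∧ p.1 < i then 1 else 0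

theorem sum_leftExp (i j : Fin n) (a : Node n → ℕ) :
    ∑ p, leftExp i j p * (a p : ℤ)
      = ((∑ t, if t < j then a (i, t) else 0 : ℕ) : ℤ)
        + ((∑ s, if s < i then a (s, j) else 0 : ℕ) : ℤ) := by
  simp only [leftExp, add_mul, Finset.sum_add_distrib]
  congr 1
  · rw [Fintype.sum_prod_type, Finset.sum_eq_single i]
    · push_cast
      exact Finset.sum_congr rfl fun t _ => by simp
    · intro s _ hs
      simp [hs]
    · simp
  · rw [Fintype.sum_prod_type_right, Finset.sum_eq_single j]
    · push_cast
      exact Finset.sum_congr rfl fun t _ => by simp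
    · intro s _ hs
      simp [hs]
    · simp

/-- Left multiplication by `x_{ij}` raises the exponent at `(i,j)`, up to a power of `q` and up to
terms in which, inside column `j`, the exponent in some row above is raised instead. -/
theorem QuantumMatrix.entry_mul_mon {x : Node n → A} (h : QuantumMatrix q x) (i j : Fin n)
    (a : Node n → ℕ) :
    x (i, j) * mon x a - q ^ (∑ p, leftExp i j p * (a p : ℤ)) • mon x (a + Pi.single (i, j) 1)
      ∈ Submodule.span ℂ {v | ∃ b, v = mon x b ∧ ∃ s < i, b (s, j) = a (s, j) + 1} := by
  obtain ⟨l₁, l₂, hl, hp, h₁, h₂⟩ := finRange_split j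
  have split : ∀ b, mon x b = colsMon x l₁ b * (colMon x b j * colsMon x l₂ b) := fun b => by
    rw [mon_eq_colsMon, hl, colsMon_append, colsMon_cons]
  have hP := h.passes_colsMon h₁ a
  set N := Submodule.span ℂ {v | ∃ b, v = mon x b ∧ ∃ s < i, b (s, j) = a (s, j) + 1}
  have rest : ∀ (s : Fin n), colsMon x l₂ (a + Pi.single (s, j) 1) = colsMon x l₂ a := fun s =>
    colsMon_congr x fun t ht i => by
      have : (i, t) ≠ (s, j) := fun e => (h₂ t ht).ne' (Prod.ext_iff.mp e).2
      simp [Pi.single_eq_of_ne this]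
  have pre : ∀ (s : Fin n), colsMon x l₁ (a + Pi.single (s, j) 1) = colsMon x l₁ a := fun s =>
    colsMon_congr x fun t ht i => by
      have : (i, t) ≠ (s, j) := fun e => (h₁ t ht).ne (Prod.ext_iff.mp e).2
      simp [Pi.single_eq_of_ne this]
  have low : ∀ v ∈ QuantumMatrix.lower x (colsAlg x l₁) i j,
      v * (colMon x a j * colsMon x l₂ a) ∈ N := by
    intro v hv
    refine mul_mem_of_mem_span ?_ hv
    rintro _ ⟨s, hs, w, hw, rfl⟩
    rw [mul_assoc, ← mul_assoc (x (s, j)), h.mul_colMon, smul_mul_assoc, mul_smul_comm]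
    refine Submodule.smul_mem _ _ ?_
    refine mul_mem_of_mem_span ?_ (h.colsAlg_le_span l₁ hp hw)
    rintro _ ⟨b, rfl⟩
    refine Submodule.subset_span
      ⟨fun p => if p.2 < j then b p else (a + Pi.single (s, j) 1 : Node n → ℕ) p, ?_, s, hs,
        by simp⟩
    rw [split, ← rest s]
    congr 1
    · exact colsMon_congr x fun t ht i => (if_pos (h₁ t ht)).symm
    · congr 1
      · exact colMon_congr x fun i => (if_neg (lt_irrefl j)).symm
      · exact colsMon_congr x fun t ht i => (if_neg (h₂ t ht).not_gt).symm
  have main := low _ (hP.2 i)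
  rw [sum_leftExp, ← Nat.cast_add, zpow_natCast, split, split, pre, rest,
    sum_of_split hl h₁ h₂ fun t => a (i, t)]
  rw [sub_mul, smul_mul_assoc, mul_assoc, mul_assoc, ← mul_assoc (x (i, j)) (colMon x a j),
    h.mul_colMon, smul_mul_assoc, mul_smul_comm, smul_smul, ← pow_add] at main
  exact main

end QuantumMatrix

/-! ### Reflection in the antidiagonal and right multiplication -/

section Transposition

variable {n : ℕ}

theorem prod_map_mul_of_commute {ι M : Type*} [Monoid M] (l : List ι) (u v : ι → M)
    (h : l.Pairwise fun j t => Commute (v j) (u t)) :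
    (l.map fun j => u j * v j).prod = (l.map u).prod * (l.map v).prod := by
  induction l with
  | nil => simp
  | cons j l ih =>
    rw [List.pairwise_cons] at h
    have hc : Commute (v j) (l.map u).prod := Commute.list_prod_right _ _ fun y hy => by
      obtain ⟨t, ht, rfl⟩ := List.mem_map.mp hy
      exact h.1 t ht
    simp only [List.map_cons, List.prod_cons]
    rw [ih h.2, mul_assoc, ← mul_assoc (v j), hc.eq, mul_assoc, mul_assoc]

/-- If antidiagonal entries commute, the ordered product by columns is the ordered product by
rows. -/
theorem orderedProd_eq_rows {M : Type*} [Monoid M] (y : Node n → M)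
    (h : ∀ {i s j t : Fin n}, i < s → j < t → Commute (y (i, t)) (y (s, j))) :
    orderedProd y
      = ((List.finRange n).map fun i => ((List.finRange n).map fun j => y (i, j)).prod).prod := by
  unfold orderedProd
  suffices ∀ l : List (Fin n), l.Pairwise (· < ·) →
      ((List.finRange n).map fun j => (l.map fun i => y (i, j)).prod).prod
        = (l.map fun i => ((List.finRange n).map fun j => y (i, j)).prod).prod from
    this _ (List.pairwise_lt_finRange n)
  intro l hl
  induction l with
  | nil => simp
  | cons i l ih =>
    rw [List.pairwise_cons] at hl
    simp only [List.map_cons, List.prod_cons]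
    rw [← ih hl.2]
    refine prod_map_mul_of_commute _ _ _ ((List.pairwise_lt_finRange n).imp fun {j t} hjt => ?_)
    refine Commute.list_prod_left _ _ fun v hv => ?_
    obtain ⟨s, hs, rfl⟩ := List.mem_map.mp hv
    exact (h (hl.1 s hs) hjt).symm

/-- Reflection of the nodes in the antidiagonal. -/
def antiTranspose (p : Node n) : Node n := (p.2.rev, p.1.rev)

theorem antiTranspose_involutive : Function.Involutive (antiTranspose (n := n)) := fun p => by
  simp [antiTranspose]

open MulOpposite

theorem orderedProd_antiTranspose {M : Type*} [Monoid M] (y : Node n → M)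
    (h : ∀ {i s j t : Fin n}, i < s → j < t → Commute (y (i, t)) (y (s, j))) :
    orderedProd (fun p => op (y (antiTranspose p))) = op (orderedProd y) := by
  have rev : ∀ g : Fin n → M,
      ((List.finRange n).map fun i => op (g i.rev)).prod = op ((List.finRange n).map g).prod := by
    intro g
    rw [op_list_prod, List.map_map, ← List.map_reverse, List.finRange_reverse, List.map_map]
    rfl
  rw [orderedProd_eq_rows y h]
  unfold orderedProd antiTranspose
  rw [← rev, List.map_congr_left]
  intro j _
  exact rev fun i => y (j.rev, i)

variable {A : Type*} [Ring A] [Algebra ℂ A] {q : ℂ} {x : Node n → A}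

/-- Reflection in the antidiagonal is an antiautomorphism of the quantum matrix relations. -/
theorem QuantumMatrix.antiTranspose (h : QuantumMatrix q x) :
    QuantumMatrix q fun p => op (x (antiTranspose p)) where
  col j his := by
    rw [← op_mul, ← op_mul, ← op_smul]
    exact congrArg op (h.row _ (Fin.rev_lt_rev.mpr his))
  row i _ _ hjt := by
    rw [← op_mul, ← op_mul, ← op_smul]
    exact congrArg op (h.col _ (Fin.rev_lt_rev.mpr hjt))
  anti his hjt := (h.anti (Fin.rev_lt_rev.mpr hjt) (Fin.rev_lt_rev.mpr his)).op
  diag his hjt := by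
    rw [← op_mul, ← op_mul, ← op_mul, ← op_smul, ← op_add]
    refine congrArg op ?_
    have h1 := h.diag (Fin.rev_lt_rev.mpr hjt) (Fin.rev_lt_rev.mpr his)
    have h2 := h.anti (Fin.rev_lt_rev.mpr hjt) (Fin.rev_lt_rev.mpr his)
    rw [h2.eq] at h1
    exact h1

theorem QuantumMatrix.mon_antiTranspose (h : QuantumMatrix q x) (a : Node n → ℕ) :
    mon (fun p => op (x (QuantizedDiffOps.antiTranspose p)))
      (fun p => a (QuantizedDiffOps.antiTranspose p)) = op (mon x a) := by
  have := orderedProd_antiTranspose (fun p => x p ^ a p)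
    fun his hjt => ((h.anti his hjt).pow_pow _ _)
  simpa only [op_pow, mon] using this

/-- The exponents of the power of `q` that appears when `x_{ij}` is moved from the right to its
place in an ordered monomial: `1` at the nodes to the right of `(i,j)` in its row and below it in
its column. -/
def rightExp (i j : Fin n) (p : Node n) : ℤ := leftExp j.rev i.rev (antiTranspose p)

/-- Right multiplication by `x_{ij}` raises the exponent at `(i,j)`, up to a power of `q` and up to
terms in which, inside row `i`, the exponent in some column further to the right is raised
instead. -/
theorem QuantumMatrix.mon_mul_entry (h : QuantumMatrix q x) (i j : Fin n) (a : Node n → ℕ) :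
    mon x a * x (i, j) - q ^ (∑ p, rightExp i j p * (a p : ℤ)) • mon x (a + Pi.single (i, j) 1)
      ∈ Submodule.span ℂ {v | ∃ b, v = mon x b ∧ ∃ t > j, b (i, t) = a (i, t) + 1} := by
  let σ : Node n → Node n := QuantizedDiffOps.antiTranspose
  have hσ : Function.Involutive σ := antiTranspose_involutive
  have key := h.antiTranspose.entry_mul_mon j.rev i.rev (a ∘ σ)
  have e1 : (a ∘ σ) + Pi.single (j.rev, i.rev) 1
      = (a + Pi.single (i, j) 1) ∘ σ := by
    funext p
    have : p = (j.rev, i.rev) ↔ σ p = (i, j) := by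
      constructor
      · rintro rfl
        simp [σ, QuantizedDiffOps.antiTranspose]
      · intro e
        rw [← hσ p, e]
        rfl
    simp [Pi.single_apply, this]
  have e2 : ∑ p, leftExp j.rev i.rev p * ((a ∘ σ) p : ℤ) = ∑ p, rightExp i j p * (a p : ℤ) := by
    refine Fintype.sum_equiv hσ.toPerm _ _ fun p => ?_
    show _ = leftExp j.rev i.rev (σ (σ p)) * (a (σ p) : ℤ)
    rw [hσ p]
    rfl
  have e3 : op (x (QuantizedDiffOps.antiTranspose (j.rev, i.rev))) = op (x (i, j)) := by
    simp [QuantizedDiffOps.antiTranspose]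
  rw [e1, e2, e3] at key
  have m := h.mon_antiTranspose
  change op (x (i, j)) * mon _ (fun p => a (σ p))
    - _ • mon _ (fun p => (a + Pi.single (i, j) 1 : Node n → ℕ) (σ p)) ∈ _ at key
  rw [m, m, ← op_mul, ← op_smul, ← op_sub] at key
  refine (Submodule.span_le (p := (Submodule.span ℂ _).comap
    (opLinearEquiv ℂ).symm.toLinearMap)).mpr ?_ key
  rintro _ ⟨b, rfl, s, hs, hb⟩
  refine Submodule.subset_span ⟨b ∘ σ, ?_, s.rev, by simpa using Fin.rev_lt_rev.mpr hs, ?_⟩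
  · have := m (b ∘ σ)
    have e : (fun p => (b ∘ σ) (σ p)) = b := by
      funext p
      exact congrArg b (hσ p)
    change mon _ (fun p => (b ∘ σ) (σ p)) = _ at this
    rw [e] at this
    rw [this]
    rfl
  · simpa [σ, QuantizedDiffOps.antiTranspose] using hb

end Transposition

/-! ### The root vectors satisfy the quantum matrix relations -/

section RootVectors

theorem qBr_comm {A : Type*} [Ring A] [Algebra ℂ A] {q : ℂ} {x y z : A} (h : Commute x y) :
    qBr q x (qBr q y z) = qBr q y (qBr q x z) := by
  have e1 : y * x = x * y := h.eq.symm
  have e2 : ∀ v, y * (x * v) = x * (y * v) := fun v => by rw [← mul_assoc, e1, mul_assoc]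
  unfold qBr
  simp only [mul_sub, sub_mul, mul_smul_comm, smul_mul_assoc, mul_assoc, e1, e2]
  module

/-- The commutation and Serre relations of the simple root vectors of type `A` produce the two
chains of `q`-commutators. -/
theorem DoubleChain.of_serre {A : Type*} [Ring A] [Algebra ℂ A] {q : ℂ} {e f : ℕ → A}
    {z : ℕ → ℕ → A} (hee : ∀ i j, i + 1 < j → Commute (e i) (e j))
    (hff : ∀ i j, i + 1 < j → Commute (f i) (f j)) (hef : ∀ i j, Commute (e i) (f j))
    (he : ∀ i, Serre q (e i) (e (i + 1))) (he' : ∀ i, Serre q (e (i + 1)) (e i))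
    (hf : ∀ i, Serre q (f i) (f (i + 1))) (hf' : ∀ i, Serre q (f (i + 1)) (f i))
    (hez : ∀ i, Commute (e (i + 1)) (z 0 0)) (hfz : ∀ i, Commute (f (i + 1)) (z 0 0))
    (h1 : Serre q (e 0) (z 0 0)) (h2 : Serre q (f 0) (z 0 0))
    (h3 : Serre q (z 0 0) (e 0)) (h4 : Serre q (z 0 0) (f 0))
    (hz0 : ∀ i, z (i + 1) 0 = qBr q (e i) (z i 0))
    (hz : ∀ i j, z i (j + 1) = qBr q (f j) (z i j)) : DoubleChain q e f z where
  serre_e := h3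
  serre_f := h4
  row j :=
    { succ := fun i => by
        induction j with
        | zero => exact hz0 i
        | succ j ih => rw [hz, hz, ih, qBr_comm (hef i j)]
      comm := hee
      serre := he
      serre' := he'
      comm_zero := fun i => by
        induction j with
        | zero => exact hez i
        | succ j ih =>
          rw [hz]
          exact commute_qBr (hef _ _) ih
      serre_zero := by
        induction j with
        | zero => exact h1
        | succ j ih =>
          rw [hz]
          exact ih.qBr_right' (hef _ _) }
  col i :=
    { succ := hz i
      comm := hff
      serre := hf
      serre' := hf'
      comm_zero := fun j => by
        induction i with
        | zero => exact hfz j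
        | succ i ih =>
          rw [hz0]
          exact commute_qBr (hef _ _).symm ih
      serre_zero := by
        induction i with
        | zero => exact h2
        | succ i ih =>
          rw [hz0]
          exact ih.qBr_right' (hef _ _).symm }

variable {n : ℕ} {q : ℂ}

theorem E_commute {a b : SimpleRoot n} (h : ¬ a.Adjacent b) : Commute (E q a) (E q b) := by
  have := RingQuot.mkAlgHom_rel ℂ (SerreRel.comm (q := q) a b h)
  simp only [map_mul] at this
  exact this

theorem E_serre {a b : SimpleRoot n} (h : a.Adjacent b) : Serre q (E q a) (E q b) := by
  have := RingQuot.mkAlgHom_rel ℂ (SerreRel.serre (q := q) a b h)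
  simp only [map_mul, map_add, map_smul] at this
  exact this

/-- `E_{μ_{k+1}}`, continued by `0` beyond the Dynkin diagram. -/
def eMu (n : ℕ) (q : ℂ) (k : ℕ) : UqPlus n q := if h : k < n - 1 then E q (.mu ⟨k, h⟩) else 0

/-- `E_{ν_{k+1}}`, continued by `0` beyond the Dynkin diagram. -/
def eNu (n : ℕ) (q : ℂ) (k : ℕ) : UqPlus n q := if h : k < n - 1 then E q (.nu ⟨k, h⟩) else 0

/-- The root vectors `Z_{ij}`, continued to all pairs of natural numbers. -/
def zRoot (n : ℕ) (q : ℂ) (i : ℕ) : ℕ → UqPlus n q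
  | 0 => i.rec (E q .beta) fun i z => qBr q (eMu n q i) z
  | j + 1 => qBr q (eNu n q j) (zRoot n q i j)

theorem serre_zero_left {A : Type*} [Ring A] [Algebra ℂ A] (z : A) : Serre q 0 z := by
  simp [Serre]

theorem serre_zero_right {A : Type*} [Ring A] [Algebra ℂ A] (z : A) : Serre q z 0 := by
  simp [Serre]

theorem doubleChain_zRoot : DoubleChain q (eMu n q) (eNu n q) (zRoot n q) := by
  refine DoubleChain.of_serre ?_ ?_ ?_ ?_ ?_ ?_ ?_ ?_ ?_ ?_ ?_ ?_ ?_ (fun i => rfl)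
    (fun i j => rfl)
  all_goals
    simp only [eMu, eNu, zRoot]
    intros
    split_ifs
    all_goals first
      | exact Commute.zero_left _
      | exact Commute.zero_right _
      | exact serre_zero_left _
      | exact serre_zero_right _
      | (refine E_commute ?_
         simp only [SimpleRoot.Adjacent, SimpleRoot.pos]
         push_cast
         rw [abs_eq zero_le_one]
         omega)
      | (refine E_serre ?_
         simp only [SimpleRoot.Adjacent, SimpleRoot.pos]
         push_cast
         rw [abs_eq zero_le_one]
         omega)

theorem zEntry_eq (i : ℕ) (hi : i < n) (j : ℕ) (hj : j < n) :
    zEntry q i hi j hj = zRoot n q i j := by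
  induction j with
  | zero =>
    rw [zEntry]
    induction i with
    | zero => rfl
    | succ i ih =>
      rw [zCol, ih (by omega)]
      have h : i < n - 1 := by omega
      simp only [zRoot, qBr, eMu, dif_pos h]
  | succ j ih =>
    rw [zEntry, ih (by omega)]
    have h : j < n - 1 := by omega
    simp only [zRoot, qBr, eNu, dif_pos h]

/-- The recursion for `W` is the one for `Z`, up to the factor `-q` in each step. -/
theorem wEntry_eq (hq : q ≠ 0) (i : ℕ) (hi : i < n) (j : ℕ) (hj : j < n) :
    wEntry q i hi j hj = (-q) ^ (i + j) • zEntry q i hi j hj := by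
  have step : ∀ (c : ℂ) (x z : UqPlus n q),
      (c • z) * x - q • (x * (c • z)) = (c * -q) • (x * z - q⁻¹ • (z * x)) := by
    intro c x z
    simp only [smul_mul_assoc, mul_smul_comm, smul_sub, smul_smul]
    match_scalars <;> field_simp
  induction j with
  | zero =>
    rw [wEntry, zEntry]
    induction i with
    | zero => simp [wCol, zCol, E, F]
    | succ i ih =>
      rw [wCol, zCol, ih (by omega), add_zero, add_zero, pow_succ]
      exact step _ _ _
  | succ j ih =>
    rw [wEntry, zEntry, ih (by omega), ← add_assoc, pow_succ]
    exact step _ _ _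

theorem quantumMatrix_Z (hq : q ≠ 0) (h2 : 1 + q ^ 2 ≠ 0) :
    QuantumMatrix q (Z q : Node n → APlus n q) where
  col j his := Subtype.ext (by
    simpa only [Z, MulMemClass.coe_mul, SetLike.val_smul, zEntry_eq] using
      doubleChain_zRoot.col_rel hq h2 _ (Fin.lt_def.mp his))
  row i _ _ hjt := Subtype.ext (by
    simpa only [Z, MulMemClass.coe_mul, SetLike.val_smul, zEntry_eq] using
      doubleChain_zRoot.row_rel hq h2 _ (Fin.lt_def.mp hjt))
  anti his hjt := Subtype.ext (by
    simpa only [Z, MulMemClass.coe_mul, SetLike.val_smul, zEntry_eq] using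
      (doubleChain_zRoot.anti hq h2 (Fin.lt_def.mp his) (Fin.lt_def.mp hjt)).eq)
  diag his hjt := Subtype.ext (by
    simpa only [Z, MulMemClass.coe_mul, Subalgebra.coe_add, SetLike.val_smul, zEntry_eq] using
      doubleChain_zRoot.diag hq h2 (Fin.lt_def.mp his) (Fin.lt_def.mp hjt))

theorem quantumMatrix_W (hq : q ≠ 0) (h2 : 1 + q ^ 2 ≠ 0) :
    QuantumMatrix q (W q : Node n → AMinus n q) where
  col j his := Subtype.ext (by
    have := doubleChain_zRoot (n := n).col_rel hq h2 j (Fin.lt_def.mp his)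
    simp only [W, MulMemClass.coe_mul, SetLike.val_smul, wEntry_eq hq, zEntry_eq, smul_mul_assoc,
      mul_smul_comm, smul_smul, this]
    congr 1; ring)
  row i _ _ hjt := Subtype.ext (by
    have := doubleChain_zRoot (n := n).row_rel hq h2 i (Fin.lt_def.mp hjt)
    simp only [W, MulMemClass.coe_mul, SetLike.val_smul, wEntry_eq hq, zEntry_eq, smul_mul_assoc,
      mul_smul_comm, smul_smul, this]
    congr 1; ring)
  anti his hjt := Subtype.ext (by
    have := (doubleChain_zRoot (n := n).anti hq h2 (Fin.lt_def.mp his) (Fin.lt_def.mp hjt)).eq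
    simp only [W, MulMemClass.coe_mul, wEntry_eq hq, zEntry_eq, smul_mul_assoc, mul_smul_comm,
      smul_smul, this]
    congr 1; ring)
  diag his hjt := Subtype.ext (by
    have := doubleChain_zRoot (n := n).diag hq h2 (Fin.lt_def.mp his) (Fin.lt_def.mp hjt)
    simp only [W, MulMemClass.coe_mul, Subalgebra.coe_add, SetLike.val_smul, wEntry_eq hq,
      zEntry_eq, smul_mul_assoc, mul_smul_comm, smul_smul, this, smul_add]
    match_scalars <;> ring)

theorem QuantumMatrix.span_mon {A : Type*} [Ring A] [Algebra ℂ A] {y : Node n → A}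
    {x : Node n → Algebra.adjoin ℂ (Set.range y)} (h : QuantumMatrix q x)
    (hx : ∀ p, (x p : A) = y p) : ⊤ ≤ Submodule.span ℂ (Set.range (mon x)) := by
  have e : Set.range x = ((↑) : Algebra.adjoin ℂ (Set.range y) → A) ⁻¹' Set.range y := by
    ext v
    constructor
    · rintro ⟨p, rfl⟩
      exact ⟨p, (hx p).symm⟩
    · rintro ⟨p, hp⟩
      exact ⟨p, Subtype.ext ((hx p).trans hp)⟩
  have := h.adjoin_le_span
  rwa [e, Algebra.adjoin_adjoin_coe_preimage, Algebra.top_toSubmodule] at this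

theorem span_ZPow (hq : q ≠ 0) (h2 : 1 + q ^ 2 ≠ 0) :
    ⊤ ≤ Submodule.span ℂ (Set.range (ZPow (n := n) q)) :=
  (quantumMatrix_Z hq h2).span_mon fun _ => rfl

theorem span_WPow (hq : q ≠ 0) (h2 : 1 + q ^ 2 ≠ 0) :
    ⊤ ≤ Submodule.span ℂ (Set.range (WPow (n := n) q)) :=
  (quantumMatrix_W hq h2).span_mon fun _ => rfl

end RootVectors

/-! ### A representation by `q`-difference operators -/

section WeightedShifts

variable {N : Type*} {q : ℂ}

/-- The weighted shift `e_a ↦ f(a) e_{a+d}` on the space with basis `e_a`, `a ∈ ℤ^N`. Negative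
exponents are allowed, so that no subtraction is truncated and all identities between shifts reduce
to identities between their weights. -/
def wShift (f : (N → ℤ) → ℂ) (d : N → ℤ) : Module.End ℂ ((N → ℤ) →₀ ℂ) :=
  Finsupp.linearCombination ℂ fun a => Finsupp.single (a + d) (f a)

theorem wShift_single (f : (N → ℤ) → ℂ) (d a : N → ℤ) :
    wShift f d (Finsupp.single a 1) = Finsupp.single (a + d) (f a) := by
  simp [wShift]

theorem wShift_single' (f : (N → ℤ) → ℂ) (d a : N → ℤ) (c : ℂ) :
    wShift f d (Finsupp.single a c) = Finsupp.single (a + d) (c * f a) := by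
  simp [wShift]

theorem wShift_ext {S T : Module.End ℂ ((N → ℤ) →₀ ℂ)}
    (h : ∀ a, S (Finsupp.single a 1) = T (Finsupp.single a 1)) : S = T :=
  Finsupp.lhom_ext' fun a => LinearMap.ext_ring (h a)

theorem wShift_mul (f g : (N → ℤ) → ℂ) (d d' : N → ℤ) :
    wShift f d * wShift g d' = wShift (fun a => f (a + d') * g a) (d' + d) := by
  refine wShift_ext fun a => ?_
  rw [Module.End.mul_apply, wShift_single, wShift_single', wShift_single, add_assoc, mul_comm]

theorem wShift_smul_eq {f g : (N → ℤ) → ℂ} {d d' : N → ℤ} {c : ℂ} (hd : d = d')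
    (h : ∀ a, f a = c * g a) : wShift f d = c • wShift g d' := by
  subst hd
  refine wShift_ext fun a => ?_
  rw [LinearMap.smul_apply, wShift_single, wShift_single, Finsupp.smul_single, h, smul_eq_mul]

theorem wShift_congr {f g : (N → ℤ) → ℂ} {d d' : N → ℤ} (hd : d = d')
    (h : ∀ a, f a = g a) : wShift f d = wShift g d' := by
  obtain rfl : f = g := funext h
  rw [hd]

theorem wShift_add_eq {f₁ f₂ f₃ : (N → ℤ) → ℂ} {d₁ d₂ d₃ : N → ℤ} {c : ℂ} (h₁ : d₁ = d₃)
    (h₂ : d₂ = d₃) (h : ∀ a, f₁ a + f₂ a = c * f₃ a) :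
    wShift f₁ d₁ + wShift f₂ d₂ = c • wShift f₃ d₃ := by
  subst h₁ h₂
  refine wShift_ext fun a => ?_
  rw [LinearMap.add_apply, LinearMap.smul_apply, wShift_single, wShift_single, wShift_single,
    ← Finsupp.single_add, h, Finsupp.smul_single, smul_eq_mul]

theorem wShift_add_eq_add {f₁ f₂ f₃ f₄ : (N → ℤ) → ℂ} {d₁ d₂ d₃ d₄ : N → ℤ} (h₁ : d₁ = d₄)
    (h₂ : d₂ = d₄) (h₃ : d₃ = d₄) (h : ∀ a, f₁ a + f₂ a = f₃ a + f₄ a) :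
    wShift f₁ d₁ + wShift f₂ d₂ = wShift f₃ d₃ + wShift f₄ d₄ := by
  subst h₁ h₂ h₃
  refine wShift_ext fun a => ?_
  simp only [LinearMap.add_apply, wShift_single, ← Finsupp.single_add, h]

/-- The `q`-integer `(q^m - q^{-m}) / (q - q⁻¹)` of an integer `m`. -/
def qNum (q : ℂ) (m : ℤ) : ℂ := (q ^ m - q ^ (-m)) / (q - q⁻¹)

theorem qNum_zero : qNum q 0 = 0 := by simp [qNum]

theorem qNum_one (h : q - q⁻¹ ≠ 0) : qNum q 1 = 1 := by simp [qNum, div_self h]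

theorem qNum_rec (hq : q ≠ 0) (m : ℤ) :
    qNum q (m + 1) + qNum q (m - 1) = (q + q⁻¹) * qNum q m := by
  unfold qNum
  rw [← add_div, ← mul_div_assoc]
  congr 1
  rw [neg_add, neg_sub, zpow_add_one₀ hq, zpow_sub_one₀ hq, zpow_add₀ hq, sub_eq_add_neg 1 m,
    zpow_add₀ hq 1, zpow_neg_one, zpow_one]
  ring

theorem q_mul_qNum_succ (hq : q ≠ 0) (h : q - q⁻¹ ≠ 0) (m : ℤ) :
    q * qNum q (m + 1) - qNum q m = q ^ (m + 1) := by
  unfold qNum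
  rw [mul_div_assoc', ← sub_div, div_eq_iff h, neg_add, zpow_add_one₀ hq, zpow_add₀ hq,
    zpow_neg_one]
  field_simp
  ring

end WeightedShifts

section Serre

theorem commute_add_add {A : Type*} [Ring A] {t₁ t₂ s₁ s₂ : A} (h₁ : Commute t₁ s₁)
    (h₂ : Commute t₂ s₂) (h : t₁ * s₂ + t₂ * s₁ = s₁ * t₂ + s₂ * t₁) :
    Commute (t₁ + t₂) (s₁ + s₂) := by
  have e₁ := h₁.eq
  have e₂ := h₂.eq
  unfold Commute SemiconjBy
  linear_combination (norm := noncomm_ring) e₁ + e₂ + h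

variable {A : Type*} [Ring A] [Algebra ℂ A] {q : ℂ}

/-- The Serre relation is compatible with the coproduct: it passes from two pairs to their sum
when the second pair `q`-commutes with the first according to the Cartan matrix. -/
theorem Serre.add (hq : q ≠ 0) {u v x y : A} (h : Serre q u v) (h' : Serre q x y)
    (hxu : x * u = q ^ 2 • (u * x)) (hxv : x * v = q⁻¹ • (v * x))
    (hyu : y * u = q⁻¹ • (u * y)) :
    Serre q (u + x) (v + y) := by
  have e1 : ∀ w, x * (u * w) = q ^ 2 • (u * (x * w)) := fun w => by
    rw [← mul_assoc, hxu, smul_mul_assoc, mul_assoc]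
  have e2 : ∀ w, x * (v * w) = q⁻¹ • (v * (x * w)) := fun w => by
    rw [← mul_assoc, hxv, smul_mul_assoc, mul_assoc]
  have e3 : ∀ w, y * (u * w) = q⁻¹ • (u * (y * w)) := fun w => by
    rw [← mul_assoc, hyu, smul_mul_assoc, mul_assoc]
  unfold Serre at *
  linear_combination (norm := skip) h + h'
  simp only [mul_add, add_mul, mul_assoc, hxu, hxv, hyu, e1, e2, e3, mul_smul_comm,
    smul_mul_assoc, smul_add, smul_smul]
  match_scalars <;> field_simp <;> ring

end Serre

section Oscillator

variable {N : Type*} {q : ℂ}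

/-- The total exponent in row `k + 1` minus that in row `k`, over the first `j` columns of a
matrix of coordinates `c`. -/
def prefixWt (c : ℕ → ℕ → N) (k j : ℕ) : (N → ℤ) →+ ℤ where
  toFun a := ∑ t ∈ Finset.range j, (a (c (k + 1) t) - a (c k t))
  map_zero' := by simp
  map_add' a b := by
    rw [← Finset.sum_add_distrib]
    exact Finset.sum_congr rfl fun t _ => by simp only [Pi.add_apply]; ring

theorem prefixWt_succ (c : ℕ → ℕ → N) (k j : ℕ) (a : N → ℤ) :
    prefixWt c k (j + 1) a = prefixWt c k j a + (a (c (k + 1) j) - a (c k j)) :=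
  Finset.sum_range_succ _ _

variable [DecidableEq N]

/-- The operator `q^{…} x_{k+1,j} ∂_{kj}` that moves one unit from row `k` to row `k + 1` in
column `j`. The weight of the preceding columns is the factor that the coproduct of the quantized
enveloping algebra puts on them. -/
def moveOp (q : ℂ) (c : ℕ → ℕ → N) (k j : ℕ) : Module.End ℂ ((N → ℤ) →₀ ℂ) :=
  wShift (fun a => q ^ prefixWt c k j a * qNum q (a (c k j)))
    (Pi.single (c (k + 1) j) 1 - Pi.single (c k j) 1)

/-- The action of the simple root vector that leads from row `k` to row `k + 1`. -/
def rowOp (q : ℂ) (c : ℕ → ℕ → N) (n k : ℕ) : Module.End ℂ ((N → ℤ) →₀ ℂ) :=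
  ∑ j ∈ Finset.range n, moveOp q c k j

/-- The action of the root vector `E_β`: multiplication by the first coordinate. -/
def firstOp (c : ℕ → ℕ → N) : Module.End ℂ ((N → ℤ) →₀ ℂ) :=
  wShift (fun _ => 1) (Pi.single (c 0 0) 1)

variable {c : ℕ → ℕ → N} (hc : ∀ {k j l t}, c k j = c l t ↔ k = l ∧ j = t)
include hc

theorem prefixWt_single (k j r t : ℕ) :
    prefixWt c k j (Pi.single (c r t) 1)
      = if t < j then (if r = k + 1 then 1 else 0) - (if r = k then 1 else 0) else 0 := by
  simp only [prefixWt, AddMonoidHom.coe_mk, ZeroHom.coe_mk, Pi.single_apply, hc,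
    Finset.sum_sub_distrib]
  simp only [ite_and, Finset.sum_ite_irrel, Finset.sum_const_zero, eq_comm (b := r),
    eq_comm (b := t)]
  split_ifs <;> simp_all

theorem moveOp_mul_moveOp (hq : q ≠ 0) (k l : ℕ) {j t : ℕ} (h : j < t) :
    moveOp q c k t * moveOp q c l j
      = q ^ ((if l = k then 2 else 0) - (if l = k + 1 then 1 else 0) - (if l + 1 = k then 1 else 0)
          : ℤ) • (moveOp q c l j * moveOp q c k t) := by
  unfold moveOp
  rw [wShift_mul, wShift_mul]
  refine wShift_smul_eq (add_comm _ _) fun a => ?_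
  have e1 : prefixWt c k t (Pi.single (c (l + 1) j) 1 - Pi.single (c l j) 1)
      = (if l = k then 2 else 0) - (if l = k + 1 then 1 else 0)
        - (if l + 1 = k then 1 else 0) := by
    rw [map_sub, prefixWt_single hc, prefixWt_single hc, if_pos h, if_pos h]
    split_ifs <;> omega
  have e2 : prefixWt c l j (Pi.single (c (k + 1) t) 1 - Pi.single (c k t) 1) = 0 := by
    rw [map_sub, prefixWt_single hc, prefixWt_single hc, if_neg h.not_gt, if_neg h.not_gt, sub_self]
  simp only [map_add, e1, e2, Pi.add_apply, Pi.sub_apply, Pi.single_apply, hc, h.ne, h.ne',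
    and_false, if_false, sub_self, add_zero, zpow_add₀ hq]
  ring

theorem moveOp_serre (hq : q ≠ 0) (k j : ℕ) :
    Serre q (moveOp q c k j) (moveOp q c (k + 1) j) := by
  unfold Serre moveOp
  simp only [wShift_mul]
  refine wShift_add_eq (by abel) (by abel) fun a => ?_
  have e := qNum_rec hq (a (c (k + 1) j) + 1)
  have h1 : k ≠ k + 1 + 1 := by omega
  simp [prefixWt_single hc, hc, h1] at e ⊢
  simp only [← sub_eq_add_neg]
  linear_combination (q ^ prefixWt c k j a) ^ 2 * q ^ prefixWt c (k + 1) j a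
    * qNum q (a (c k j)) * qNum q (a (c k j) - 1) * e

theorem moveOp_serre' (hq : q ≠ 0) (k j : ℕ) :
    Serre q (moveOp q c (k + 1) j) (moveOp q c k j) := by
  unfold Serre moveOp
  simp only [wShift_mul]
  refine wShift_add_eq (by abel) (by abel) fun a => ?_
  have e := qNum_rec hq (a (c (k + 1) j))
  have h1 : k ≠ k + 1 + 1 := by omega
  simp [prefixWt_single hc, hc, h1] at e ⊢
  simp only [← sub_eq_add_neg]
  linear_combination (q ^ prefixWt c (k + 1) j a) ^ 2 * q ^ prefixWt c k j a
    * qNum q (a (c k j)) * qNum q (a (c (k + 1) j)) * e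

theorem moveOp_serre_first (hq : q ≠ 0) :
    Serre q (moveOp q c 0 0) (firstOp c) := by
  unfold Serre moveOp firstOp
  simp only [wShift_mul]
  refine wShift_add_eq (by abel) (by abel) fun a => ?_
  have e := qNum_rec hq (a (c 0 0))
  simp [prefixWt_single hc, hc] at e ⊢
  simp only [← sub_eq_add_neg]
  linear_combination (q ^ prefixWt c 0 0 a) ^ 2 * qNum q (a (c 0 0)) * e

theorem first_serre_moveOp (hq : q ≠ 0) :
    Serre q (firstOp c) (moveOp q c 0 0) := by
  unfold Serre moveOp firstOp
  simp only [wShift_mul]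
  refine wShift_add_eq (by abel) (by abel) fun a => ?_
  have e := qNum_rec hq (a (c 0 0) + 1)
  simp [prefixWt_single hc] at e ⊢
  linear_combination q ^ prefixWt c 0 0 a * e

theorem moveOp_commute {k l : ℕ} (hkl : k + 1 < l) (j : ℕ) :
    Commute (moveOp q c k j) (moveOp q c l j) := by
  unfold moveOp Commute SemiconjBy
  rw [wShift_mul, wShift_mul]
  refine wShift_congr (add_comm _ _) fun a => ?_
  have h1 : k ≠ l := by omega
  have h2 : k + 1 ≠ l := by omega
  have h3 : k ≠ l + 1 := by omega
  simp only [map_add, map_sub, prefixWt_single hc, lt_irrefl, if_false, sub_self, add_zero,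
    Pi.add_apply, Pi.sub_apply, Pi.single_apply, hc, and_true, h1, h2, h3, h1.symm, h2.symm,
    h3.symm]
  ring

theorem rowOp_commute (hq : q ≠ 0) (n : ℕ) {k l : ℕ} (hkl : k + 1 < l) :
    Commute (rowOp q c n k) (rowOp q c n l) := by
  refine Commute.sum_left _ _ _ fun j _ => Commute.sum_right _ _ _ fun t _ => ?_
  have h1 : k ≠ l := by omega
  have h2 : k + 1 ≠ l := by omega
  have h3 : k ≠ l + 1 := by omega
  rcases lt_trichotomy j t with h | rfl | h
  · have := moveOp_mul_moveOp hc hq l k h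
    simp only [h1, h2, h3, if_false, sub_self, zpow_zero, one_smul] at this
    exact this.symm
  · exact moveOp_commute hc hkl j
  · have := moveOp_mul_moveOp hc hq k l h
    simp only [h1.symm, h2.symm, h3.symm, if_false, sub_self, zpow_zero, one_smul] at this
    exact this

/-- A `moveOp` in a later column `q`-commutes with the action on the earlier columns. -/
theorem moveOp_mul_rowOp (hq : q ≠ 0) (k l m : ℕ) :
    moveOp q c k m * rowOp q c m l
      = q ^ ((if l = k then 2 else 0) - (if l = k + 1 then 1 else 0) - (if l + 1 = k then 1 else 0)
          : ℤ) • (rowOp q c m l * moveOp q c k m) := by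
  unfold rowOp
  rw [Finset.mul_sum, Finset.sum_mul, Finset.smul_sum]
  exact Finset.sum_congr rfl fun j hj => moveOp_mul_moveOp hc hq k l (Finset.mem_range.mp hj)

theorem rowOp_serre (hq : q ≠ 0) (n k : ℕ) :
    Serre q (rowOp q c n k) (rowOp q c n (k + 1)) := by
  induction n with
  | zero => simp [rowOp, Serre]
  | succ m ih =>
    have e : ∀ l, rowOp q c (m + 1) l = rowOp q c m l + moveOp q c l m := fun l =>
      Finset.sum_range_succ _ _
    have h1 : k ≠ k + 1 + 1 := by omega
    rw [e, e]
    refine ih.add hq (moveOp_serre hc hq k m) ?_ ?_ ?_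
    · simpa [h1, h1.symm] using moveOp_mul_rowOp hc hq k k m
    · simpa [h1, h1.symm] using moveOp_mul_rowOp hc hq k (k + 1) m
    · simpa [h1, h1.symm] using moveOp_mul_rowOp hc hq (k + 1) k m

theorem rowOp_serre' (hq : q ≠ 0) (n k : ℕ) :
    Serre q (rowOp q c n (k + 1)) (rowOp q c n k) := by
  induction n with
  | zero => simp [rowOp, Serre]
  | succ m ih =>
    have e : ∀ l, rowOp q c (m + 1) l = rowOp q c m l + moveOp q c l m := fun l =>
      Finset.sum_range_succ _ _
    have h1 : k ≠ k + 1 + 1 := by omega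
    rw [e, e]
    refine ih.add hq (moveOp_serre' hc hq k m) ?_ ?_ ?_
    · simpa [h1, h1.symm] using moveOp_mul_rowOp hc hq (k + 1) (k + 1) m
    · simpa [h1, h1.symm] using moveOp_mul_rowOp hc hq (k + 1) k m
    · simpa [h1, h1.symm] using moveOp_mul_rowOp hc hq k (k + 1) m

/-- The weight of `moveOp` in column `j` between rows `k`, `k + 1` is not affected by a transposed
move in row `i` between columns `l`, `l + 1`, unless both concern the same `2 × 2` block. -/
theorem moveOp_weight_add {k l i j : ℕ} (h : (j ≠ l ∧ j ≠ l + 1) ∨ (i ≠ k ∧ i ≠ k + 1))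
    (a : N → ℤ) :
    q ^ prefixWt c k j (a + (Pi.single (c i (l + 1)) 1 - Pi.single (c i l) 1))
        * qNum q ((a + (Pi.single (c i (l + 1)) 1 - Pi.single (c i l) 1) : N → ℤ) (c k j))
      = q ^ prefixWt c k j a * qNum q (a (c k j)) := by
  have e1 : prefixWt c k j (Pi.single (c i (l + 1)) 1 - Pi.single (c i l) 1) = 0 := by
    rw [map_sub, prefixWt_single hc, prefixWt_single hc]
    split_ifs <;> omega
  have e2 : (Pi.single (c i (l + 1)) 1 - Pi.single (c i l) 1 : N → ℤ) (c k j) = 0 := by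
    simp only [Pi.sub_apply, Pi.single_apply, hc]
    split_ifs <;> omega
  rw [map_add, e1, Pi.add_apply, e2, add_zero, add_zero]

theorem moveOp_commute_transpose {k l i j : ℕ}
    (h : (j ≠ l ∧ j ≠ l + 1) ∨ (i ≠ k ∧ i ≠ k + 1)) :
    Commute (moveOp q c k j) (moveOp q (fun r t => c t r) l i) := by
  unfold moveOp Commute SemiconjBy
  rw [wShift_mul, wShift_mul]
  refine wShift_congr (add_comm _ _) fun a => ?_
  rw [moveOp_weight_add hc h,
    moveOp_weight_add (c := fun r t => c t r) (fun {_ _ _ _} => hc.trans and_comm) h.symm,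
    mul_comm]

/-- In a `2 × 2` block, the move between the rows commutes with the move between the columns. -/
theorem moveOp_block_commute (hq : q ≠ 0) (h : q - q⁻¹ ≠ 0) (k l : ℕ) :
    Commute (moveOp q c k l + moveOp q c k (l + 1))
      (moveOp q (fun r t => c t r) l k + moveOp q (fun r t => c t r) l (k + 1)) := by
  have hc' : ∀ {k j l t}, (fun r t => c t r) k j = (fun r t => c t r) l t ↔ k = l ∧ j = t :=
    fun {_ _ _ _} => hc.trans and_comm
  have c1 : Commute (moveOp q c k l) (moveOp q (fun r t => c t r) l k) := by
    unfold moveOp Commute SemiconjBy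
    rw [wShift_mul, wShift_mul]
    refine wShift_congr (add_comm _ _) fun a => ?_
    simp [prefixWt_single hc, prefixWt_single hc', hc]
    ring
  have c2 : Commute (moveOp q c k (l + 1)) (moveOp q (fun r t => c t r) l (k + 1)) := by
    unfold moveOp Commute SemiconjBy
    rw [wShift_mul, wShift_mul]
    refine wShift_congr (add_comm _ _) fun a => ?_
    simp [prefixWt_single hc, prefixWt_single hc', hc, zpow_add₀ hq]
    ring
  have c3 : moveOp q c k l * moveOp q (fun r t => c t r) l (k + 1)
        + moveOp q c k (l + 1) * moveOp q (fun r t => c t r) l k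
      = moveOp q (fun r t => c t r) l k * moveOp q c k (l + 1)
        + moveOp q (fun r t => c t r) l (k + 1) * moveOp q c k l := by
    unfold moveOp
    simp only [wShift_mul]
    refine wShift_add_eq_add (by abel) (by abel) (by abel) fun a => ?_
    have e1 := q_mul_qNum_succ hq h (a (c k (l + 1)))
    have e2 := q_mul_qNum_succ hq h (a (c (k + 1) l))
    rw [zpow_add_one₀ hq] at e1 e2
    simp [prefixWt_single hc, prefixWt_single hc', hc, zpow_add₀ hq]
    field_simp
    have key : q ^ prefixWt c k (l + 1) a * q ^ prefixWt (fun r t => c t r) l k a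
          * q ^ a (c k (l + 1))
        = q ^ prefixWt c k l a * q ^ prefixWt (fun r t => c t r) l (k + 1) a
          * q ^ a (c (k + 1) l) := by
      rw [prefixWt_succ, prefixWt_succ]
      simp only [← zpow_add₀ hq]
      congr 1
      ring
    linear_combination qNum q (a (c k l)) *
      (q ^ prefixWt c k (l + 1) a * q ^ prefixWt (fun r t => c t r) l k a * e1
        - q ^ prefixWt c k l a * q ^ prefixWt (fun r t => c t r) l (k + 1) a * e2 + q * key)
  exact commute_add_add (A := Module.End ℂ ((N → ℤ) →₀ ℂ)) c1 c2 c3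

/-- The moves between rows commute with the moves between columns. -/
theorem rowOp_commute_transpose (hq : q ≠ 0) (h : q - q⁻¹ ≠ 0) {n k l : ℕ} (hk : k + 1 < n)
    (hl : l + 1 < n) : Commute (rowOp q c n k) (rowOp q (fun r t => c t r) n l) := by
  have split : ∀ (c : ℕ → ℕ → N) (r : ℕ) {m : ℕ}, m + 1 < n → rowOp q c n r
      = ∑ j ∈ ((Finset.range n).erase m).erase (m + 1), moveOp q c r j
        + (moveOp q c r m + moveOp q c r (m + 1)) := by
    intro c r m hm
    rw [add_comm (moveOp q c r m), ← add_assoc, Finset.sum_erase_add _ _ (by simp [hm]),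
      Finset.sum_erase_add _ _ (by simp; omega)]
    rfl
  have ne : ∀ {m j : ℕ}, j ∈ ((Finset.range n).erase m).erase (m + 1) → j ≠ m ∧ j ≠ m + 1 :=
    fun hj => by
      simp only [Finset.mem_erase] at hj
      exact ⟨hj.2.1, hj.1⟩
  have rest : Commute (∑ j ∈ ((Finset.range n).erase l).erase (l + 1), moveOp q c k j)
      (rowOp q (fun r t => c t r) n l) :=
    Commute.sum_left _ _ _ fun j hj => Commute.sum_right _ _ _ fun i _ =>
      moveOp_commute_transpose hc (Or.inl (ne hj))
  rw [split c k hl]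
  refine rest.add_left ?_
  rw [split _ l hk]
  refine Commute.add_right (Commute.sum_right _ _ _ fun i hi => ?_)
    (moveOp_block_commute hc hq h k l)
  exact (moveOp_commute_transpose hc (Or.inr (ne hi))).add_left
    (moveOp_commute_transpose hc (Or.inr (ne hi)))

theorem moveOp_mul_firstOp (k j : ℕ) (hkj : k ≠ 0 ∨ j ≠ 0) (hq : q ≠ 0) :
    moveOp q c k j * firstOp c
      = (if k = 0 then q⁻¹ else 1 : ℂ) • (firstOp c * moveOp q c k j) := by
  unfold moveOp firstOp
  rw [wShift_mul, wShift_mul]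
  refine wShift_smul_eq (add_comm _ _) fun a => ?_
  have e2 : (Pi.single (c 0 0) 1 : N → ℤ) (c k j) = 0 := by
    simp only [Pi.single_apply, hc]
    rw [if_neg (by omega)]
  rw [map_add, prefixWt_single hc, Pi.add_apply, e2]
  have hk : (0 = k) ↔ k = 0 := eq_comm
  rcases Nat.eq_zero_or_pos k with rfl | h
  · have hj : 0 < j := by omega
    simp [hj, zpow_add₀ hq]
    ring
  · simp [h.ne, h.ne']

theorem rowOp_commute_firstOp (hq : q ≠ 0) (n k : ℕ) :
    Commute (rowOp q c n (k + 1)) (firstOp c) :=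
  Commute.sum_left _ _ _ fun j _ => by
    have := moveOp_mul_firstOp hc (k + 1) j (Or.inl k.succ_ne_zero) hq
    rwa [if_neg k.succ_ne_zero, one_smul] at this

theorem rowOp_serre_firstOp (hq : q ≠ 0) (n : ℕ) :
    Serre q (rowOp q c n 0) (firstOp c) := by
  cases n with
  | zero => simp [rowOp, Serre]
  | succ n =>
    induction n with
    | zero => simpa [rowOp] using moveOp_serre_first hc hq
    | succ n ih =>
      rw [rowOp, Finset.sum_range_succ, ← add_zero (firstOp c)]
      refine ih.add hq (serre_zero_right _) ?_ ?_ (by simp)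
      · simpa using moveOp_mul_rowOp hc hq 0 0 (n + 1)
      · simpa using moveOp_mul_firstOp hc 0 (n + 1) (Or.inr n.succ_ne_zero) hq

theorem firstOp_serre_rowOp (hq : q ≠ 0) (n : ℕ) :
    Serre q (firstOp c) (rowOp q c n 0) := by
  cases n with
  | zero => simp [rowOp, Serre]
  | succ n =>
    induction n with
    | zero => simpa [rowOp] using first_serre_moveOp hc hq
    | succ n ih =>
      rw [rowOp, Finset.sum_range_succ, ← add_zero (firstOp c)]
      refine ih.add hq (serre_zero_left _) (by simp) (by simp) ?_
      simpa using moveOp_mul_firstOp hc 0 (n + 1) (Or.inr n.succ_ne_zero) hq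

end Oscillator

/-! ### The action of the root vectors on monomials -/

section Representation

variable {n : ℕ} {q : ℂ}

/-- The action of the generators of `U_q^+`; the vector `e_a` stands for the monomial `Z^a`, on
which `E_β` acts by left multiplication and the compact root vectors by the adjoint action. -/
def repGen (n : ℕ) (q : ℂ) : SimpleRoot n → Module.End ℂ ((ℕ × ℕ → ℤ) →₀ ℂ)
  | .beta => firstOp Prod.mk
  | .mu k => rowOp q Prod.mk n k
  | .nu k => rowOp q (fun r t => (t, r)) n k

theorem repGen_commute (hq : q ≠ 0) (h : q - q⁻¹ ≠ 0) {a b : SimpleRoot n}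
    (hab : ¬ a.Adjacent b) : Commute (repGen n q a) (repGen n q b) := by
  have h1 : ∀ {k j l t : ℕ}, (k, j) = (l, t) ↔ k = l ∧ j = t := Prod.mk_inj
  have h2 : ∀ {k j l t : ℕ}, (j, k) = (t, l) ↔ k = l ∧ j = t := Prod.mk_inj.trans and_comm
  simp only [SimpleRoot.Adjacent, abs_eq zero_le_one] at hab
  rcases a with _ | ⟨k, hk⟩ | ⟨k, hk⟩ <;> rcases b with _ | ⟨l, hl⟩ | ⟨l, hl⟩ <;>
    simp only [SimpleRoot.pos, repGen] at hab ⊢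
  · exact Commute.refl _
  · obtain ⟨l, rfl⟩ := Nat.exists_eq_succ_of_ne_zero (n := l) (by omega)
    exact (rowOp_commute_firstOp h1 hq n l).symm
  · obtain ⟨l, rfl⟩ := Nat.exists_eq_succ_of_ne_zero (n := l) (by omega)
    exact (rowOp_commute_firstOp (c := fun r t => (t, r)) h2 hq n l).symm
  · obtain ⟨k, rfl⟩ := Nat.exists_eq_succ_of_ne_zero (n := k) (by omega)
    exact rowOp_commute_firstOp h1 hq n k
  · rcases lt_trichotomy k l with h | rfl | h
    · exact rowOp_commute h1 hq n (by omega)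
    · exact Commute.refl _
    · exact (rowOp_commute h1 hq n (by omega)).symm
  · exact rowOp_commute_transpose h1 hq h (by omega) (by omega)
  · obtain ⟨k, rfl⟩ := Nat.exists_eq_succ_of_ne_zero (n := k) (by omega)
    exact rowOp_commute_firstOp (c := fun r t => (t, r)) h2 hq n k
  · exact (rowOp_commute_transpose h1 hq h (by omega) (by omega)).symm
  · rcases lt_trichotomy k l with h | rfl | h
    · exact rowOp_commute h2 hq n (by omega)
    · exact Commute.refl _
    · exact (rowOp_commute h2 hq n (by omega)).symm

theorem repGen_serre (hq : q ≠ 0) {a b : SimpleRoot n} (hab : a.Adjacent b) :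
    Serre q (repGen n q a) (repGen n q b) := by
  have h1 : ∀ {k j l t : ℕ}, (k, j) = (l, t) ↔ k = l ∧ j = t := Prod.mk_inj
  have h2 : ∀ {k j l t : ℕ}, (j, k) = (t, l) ↔ k = l ∧ j = t := Prod.mk_inj.trans and_comm
  simp only [SimpleRoot.Adjacent, abs_eq zero_le_one] at hab
  rcases a with _ | ⟨k, hk⟩ | ⟨k, hk⟩ <;> rcases b with _ | ⟨l, hl⟩ | ⟨l, hl⟩ <;>
    simp only [SimpleRoot.pos, repGen] at hab ⊢
  · omega
  · obtain rfl : l = 0 := by omega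
    exact firstOp_serre_rowOp h1 hq n
  · obtain rfl : l = 0 := by omega
    exact firstOp_serre_rowOp (c := fun r t => (t, r)) h2 hq n
  · obtain rfl : k = 0 := by omega
    exact rowOp_serre_firstOp h1 hq n
  · obtain rfl | rfl : l = k + 1 ∨ k = l + 1 := by omega
    · exact rowOp_serre h1 hq n k
    · exact rowOp_serre' h1 hq n l
  · omega
  · obtain rfl : k = 0 := by omega
    exact rowOp_serre_firstOp (c := fun r t => (t, r)) h2 hq n
  · omega
  · obtain rfl | rfl : l = k + 1 ∨ k = l + 1 := by omega
    · exact rowOp_serre h2 hq n k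
    · exact rowOp_serre' h2 hq n l

/-- The representation of `U_q^+` by `q`-difference operators. -/
def rep (n : ℕ) (hq : q ≠ 0) (h : q - q⁻¹ ≠ 0) :
    UqPlus n q →ₐ[ℂ] Module.End ℂ ((ℕ × ℕ → ℤ) →₀ ℂ) :=
  RingQuot.liftAlgHom ℂ ⟨FreeAlgebra.lift ℂ (repGen n q), fun x y hxy => by
    cases hxy with
    | comm a b hab =>
      simpa only [map_mul, FreeAlgebra.lift_ι_apply] using (repGen_commute hq h hab).eq
    | serre a b hab =>
      have := repGen_serre hq hab
      unfold Serre at this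
      simpa only [map_mul, map_add, map_smul, FreeAlgebra.lift_ι_apply] using this⟩

theorem rep_E (hq : q ≠ 0) (h : q - q⁻¹ ≠ 0) (a : SimpleRoot n) :
    rep n hq h (E q a) = repGen n q a := by
  simp [rep, E]

theorem rep_qBr (hq : q ≠ 0) (h : q - q⁻¹ ≠ 0) (x z : UqPlus n q) (v : (ℕ × ℕ → ℤ) →₀ ℂ) :
    rep n hq h (qBr q x z) v
      = rep n hq h x (rep n hq h z v) - q⁻¹ • rep n hq h z (rep n hq h x v) := by
  simp [qBr]

theorem rowOp_single {N : Type*} [DecidableEq N] (c : ℕ → ℕ → N) (m k : ℕ) (a : N → ℤ) :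
    rowOp q c m k (Finsupp.single a 1) = ∑ j ∈ Finset.range m,
      Finsupp.single (a + (Pi.single (c (k + 1) j) 1 - Pi.single (c k j) 1))
        (q ^ prefixWt c k j a * qNum q (a (c k j))) := by
  rw [rowOp, LinearMap.sum_apply]
  exact Finset.sum_congr rfl fun j _ => wShift_single _ _ _

theorem rep_zRoot_zero (hq : q ≠ 0) (h : q - q⁻¹ ≠ 0) {i : ℕ} (hi : i < n) (a : ℕ × ℕ → ℤ)
    (ha : ∀ s < i, a (s, 0) = 0) :
    rep n hq h (zRoot n q i 0) (Finsupp.single a 1)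
      = Finsupp.single (a + Pi.single (i, 0) 1) 1 := by
  induction i generalizing a with
  | zero =>
    show rep n hq h (E q .beta) _ = _
    rw [rep_E, repGen, firstOp, wShift_single]
  | succ i ih =>
    have h1 : ∀ {k j l t : ℕ}, (k, j) = (l, t) ↔ k = l ∧ j = t := Prod.mk_inj
    have hi' : i < n - 1 := by omega
    obtain ⟨m, rfl⟩ := Nat.exists_eq_succ_of_ne_zero (n := n) (by omega)
    have ih' := fun a ha => ih (by omega) a ha
    have scale : ∀ (a : ℕ × ℕ → ℤ) (w : ℂ), Finsupp.single a w = w • Finsupp.single a 1 := by simp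
    have e : zRoot (m + 1) q (i + 1) 0 = qBr q (E q (.mu ⟨i, hi'⟩)) (zRoot (m + 1) q i 0) := by
      simp only [zRoot, eMu, dif_pos hi']
    rw [e, rep_qBr, rep_E, repGen, ih' a fun s hs => ha s (by omega), rowOp_single, rowOp_single,
      Finset.sum_range_succ', Finset.sum_range_succ', ha i (by omega), qNum_zero, mul_zero,
      Finsupp.single_zero, add_zero, map_sum, Finset.smul_sum, add_comm, add_sub_assoc,
      ← Finset.sum_sub_distrib, Finset.sum_eq_zero, add_zero]
    · have e1 : prefixWt Prod.mk i 0 (a + Pi.single (i, 0) 1) = 0 := rfl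
      have e2 : (a + Pi.single (i, 0) 1 : ℕ × ℕ → ℤ) (i, 0) = 1 := by simp [ha i (by omega)]
      rw [e1, e2, qNum_one h, zpow_zero, mul_one]
      congr 1
      abel
    · intro t _
      rw [scale _ (_ * _), scale _ (_ * _), map_smul, ih']
      · rw [map_add, prefixWt_single h1]
        have e2 : (a + Pi.single (i, 0) 1 : ℕ × ℕ → ℤ) (i, t + 1) = a (i, t + 1) := by simp
        have e3 : a + Pi.single (i, 0) 1 + (Pi.single (i + 1, t + 1) 1 - Pi.single (i, t + 1) 1)
            = a + (Pi.single (i + 1, t + 1) 1 - Pi.single (i, t + 1) 1) + Pi.single (i, 0) 1 := by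
          abel
        rw [e2, e3, smul_smul, sub_eq_zero]
        congr 1
        simp [zpow_add₀ hq]
        ring
      · intro s hs
        simp [ha s (by omega)]

/-- `Z_{ij}` raises the exponent at `(i,j)` of the monomials in which it comes first. In the
`q`-commutators that define it only one term survives: the exponents that the others would lower
vanish, or the others cancel. -/
theorem rep_zRoot (hq : q ≠ 0) (h : q - q⁻¹ ≠ 0) {i j : ℕ} (hi : i < n) (hj : j < n)
    (a : ℕ × ℕ → ℤ) (ha : ∀ s t, s < n → t < j ∨ (t = j ∧ s < i) → a (s, t) = 0) :
    rep n hq h (zRoot n q i j) (Finsupp.single a 1)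
      = Finsupp.single (a + Pi.single (i, j) 1) 1 := by
  induction j generalizing a with
  | zero => exact rep_zRoot_zero hq h hi a fun s hs => ha s 0 (by omega) (Or.inr ⟨rfl, hs⟩)
  | succ j ih =>
    have hj' : j < n - 1 := by omega
    have e : zRoot n q i (j + 1) = qBr q (E q (.nu ⟨j, hj'⟩)) (zRoot n q i j) := by
      simp only [zRoot, eNu, dif_pos hj']
    have h1 : rowOp q (fun r t => (t, r)) n j (Finsupp.single a 1) = 0 := by
      rw [rowOp_single]
      refine Finset.sum_eq_zero fun s hs => ?_
      rw [ha s j (Finset.mem_range.mp hs) (Or.inl (Nat.lt_succ_self j)), qNum_zero, mul_zero,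
        Finsupp.single_zero]
    rw [e, rep_qBr, rep_E, repGen, h1, map_zero, smul_zero, sub_zero,
      ih (by omega) a fun s t hs ht => ha s t hs (Or.inl (by omega)), rowOp_single,
      Finset.sum_eq_single i]
    · have e1 : prefixWt (fun r t => (t, r)) j i (a + Pi.single (i, j) 1) = 0 := by
        show ∑ s ∈ Finset.range i, _ = (0 : ℤ)
        refine Finset.sum_eq_zero fun s hs => ?_
        have hs := Finset.mem_range.mp hs
        have e3 : a (s, j + 1) = 0 := ha s (j + 1) (by omega) (Or.inr ⟨rfl, hs⟩)
        have e4 : a (s, j) = 0 := ha s j (by omega) (Or.inl (Nat.lt_succ_self j))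
        simp [e3, e4, hs.ne]
      have e2 : (a + Pi.single (i, j) 1 : ℕ × ℕ → ℤ) (i, j) = 1 := by
        simp [ha i j hi (Or.inl (Nat.lt_succ_self j))]
      rw [e1, e2, qNum_one h, zpow_zero, mul_one]
      congr 1
      abel
    · intro s hs hsi
      have e2 : (a + Pi.single (i, j) 1 : ℕ × ℕ → ℤ) (s, j) = 0 := by
        simp [ha s j (Finset.mem_range.mp hs) (Or.inl (Nat.lt_succ_self j)), hsi]
      rw [e2, qNum_zero, mul_zero, Finsupp.single_zero]
    · intro hi'
      exact absurd (Finset.mem_range.mpr hi) hi'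

/-! ### Linear independence of the ordered monomials -/

/-- The nodes in the order of the ordered monomials. -/
def nodeList (n : ℕ) : List (Node n) :=
  (List.finRange n).flatMap fun j => (List.finRange n).map fun i => (i, j)

theorem orderedProd_eq {R : Type*} [Monoid R] (y : Node n → R) :
    orderedProd y = ((nodeList n).map y).prod := by
  simp only [orderedProd, nodeList, List.flatMap_def, List.map_flatten, List.prod_flatten,
    List.map_map, Function.comp_def]

theorem sum_nodeList {M : Type*} [AddCommMonoid M] (f : Node n → M) :
    ((nodeList n).map f).sum = ∑ p, f p := by
  rw [Fintype.sum_prod_type_right]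
  simp only [nodeList, List.flatMap_def, List.map_flatten, List.sum_flatten, List.map_map,
    Fin.sum_univ_def, Function.comp_def]

theorem nodeList_pairwise :
    (nodeList n).Pairwise fun p r => p.2 < r.2 ∨ (p.2 = r.2 ∧ p.1 < r.1) := by
  rw [nodeList, List.pairwise_flatMap]
  constructor
  · intro j _
    rw [List.pairwise_map]
    exact (List.pairwise_lt_finRange n).imp fun h => Or.inr ⟨rfl, h⟩
  · refine (List.pairwise_lt_finRange n).imp fun {j t} h p hp r hr => Or.inl ?_
    obtain ⟨i, -, rfl⟩ := List.mem_map.mp hp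
    obtain ⟨s, -, rfl⟩ := List.mem_map.mp hr
    exact h

/-- The unit vector of a node, among exponent vectors indexed by `ℕ × ℕ`. -/
def toExp (p : Node n) : ℕ × ℕ → ℤ := Pi.single ((p.1 : ℕ), (p.2 : ℕ)) 1

theorem sum_toExp_injective :
    Function.Injective fun e : Node n → ℕ => ∑ p, e p • toExp p := by
  intro e e' h
  have key : ∀ (e : Node n → ℕ) (r : Node n),
      (∑ p, e p • toExp p) ((r.1 : ℕ), (r.2 : ℕ)) = (e r : ℤ) := by
    intro e r
    rw [Finset.sum_apply, Finset.sum_eq_single r]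
    · simp [toExp]
    · intro p _ hp
      have : ((r.1 : ℕ), (r.2 : ℕ)) ≠ ((p.1 : ℕ), (p.2 : ℕ)) := fun e => hp (by
        simp only [Prod.mk.injEq, Fin.val_inj] at e
        exact (Prod.ext e.1 e.2).symm)
      simp [toExp, Pi.single_eq_of_ne this]
    · simp
  funext r
  have := congrFun h ((r.1 : ℕ), (r.2 : ℕ))
  simp only [key] at this
  exact_mod_cast this

/-- Operators that raise the exponents of the monomials in which they come first, up to nonzero
factors, produce multiples of distinct basis vectors. -/
theorem prod_raise {y : Node n → Module.End ℂ ((ℕ × ℕ → ℤ) →₀ ℂ)} {κ : Node n → ℂ}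
    (hκ : ∀ p, κ p ≠ 0)
    (hy : ∀ (p : Node n) (a : ℕ × ℕ → ℤ),
      (∀ s t, s < n → t < (p.2 : ℕ) ∨ (t = p.2 ∧ s < (p.1 : ℕ)) → a (s, t) = 0) →
      y p (Finsupp.single a 1) = Finsupp.single (a + toExp p) (κ p)) (e : Node n → ℕ) :
    ∃ K : ℂˣ, orderedProd (fun p => y p ^ e p) (Finsupp.single 0 1)
      = K • Finsupp.single (∑ p, e p • toExp p) 1 := by
  rw [orderedProd_eq, ← sum_nodeList]
  have hp := nodeList_pairwise (n := n)
  generalize nodeList n = l at hp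
  induction l with
  | nil => exact ⟨1, by simp⟩
  | cons p l ih =>
    rw [List.pairwise_cons] at hp
    obtain ⟨K, hK⟩ := ih hp.2
    set a := (l.map fun p => e p • toExp p).sum with ha
    have ha0 : ∀ s t, s < n → t < (p.2 : ℕ) ∨ (t = p.2 ∧ s < (p.1 : ℕ)) → a (s, t) = 0 := by
      intro s t hs ht
      have : ∀ r ∈ l, (e r • toExp r) (s, t) = 0 := by
        intro r hr
        have hlt := hp.1 r hr
        have : (s, t) ≠ ((r.1 : ℕ), (r.2 : ℕ)) := by
          simp only [ne_eq, Prod.mk.injEq]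
          rcases hlt with hlt | ⟨hlt, hlt'⟩
          · have := Fin.lt_def.mp hlt
            omega
          · have := Fin.lt_def.mp hlt'
            have := congrArg Fin.val hlt
            omega
        simp [toExp, Pi.single_eq_of_ne this]
      rw [ha]
      clear hK ha hp ih
      clear_value a
      induction l with
      | nil => rfl
      | cons r l ih =>
        rw [List.map_cons, List.sum_cons, Pi.add_apply, this r (by simp),
          ih fun r hr => this r (by simp [hr]), add_zero]
    have pow : ∀ m : ℕ, ∃ K : ℂˣ, (y p ^ m) (Finsupp.single a 1)
        = K • Finsupp.single (m • toExp p + a) 1 := by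
      intro m
      induction m with
      | zero => exact ⟨1, by simp⟩
      | succ m ihm =>
        obtain ⟨K', hK'⟩ := ihm
        refine ⟨K' * Units.mk0 _ (hκ p), ?_⟩
        rw [pow_succ', Module.End.mul_apply, hK', Units.smul_def, map_smul, hy]
        · rw [Units.smul_def, Units.val_mul, Units.val_mk0, mul_smul, Finsupp.smul_single (κ p),
            smul_eq_mul, mul_one, succ_nsmul]
          congr 2
          abel
        · intro s t hs ht
          have : (s, t) ≠ ((p.1 : ℕ), (p.2 : ℕ)) := by
            simp only [ne_eq, Prod.mk.injEq]
            omega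
          simp [ha0 s t hs ht, toExp, Pi.single_eq_of_ne this]
    obtain ⟨K', hK'⟩ := pow (e p)
    refine ⟨K * K', ?_⟩
    rw [List.map_cons, List.prod_cons, Module.End.mul_apply, hK, Units.smul_def, map_smul, hK',
      List.map_cons, List.sum_cons, ← ha, mul_smul]
    rfl

theorem linearIndependent_mon {S : Subalgebra ℂ (UqPlus n q)} (hq : q ≠ 0) (h : q - q⁻¹ ≠ 0)
    {x : Node n → S} {κ : Node n → ℂ} (hκ : ∀ p, κ p ≠ 0)
    (hx : ∀ p, (x p : UqPlus n q) = κ p • zRoot n q p.1 p.2) :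
    LinearIndependent ℂ (mon x) := by
  let ρ : S →ₐ[ℂ] Module.End ℂ ((ℕ × ℕ → ℤ) →₀ ℂ) := (rep n hq h).comp S.val
  let φ : S →ₗ[ℂ] ((ℕ × ℕ → ℤ) →₀ ℂ) := (LinearMap.applyₗ (Finsupp.single 0 1)).comp ρ.toLinearMap
  refine LinearIndependent.of_comp φ ?_
  have hy : ∀ (p : Node n) (a : ℕ × ℕ → ℤ),
      (∀ s t, s < n → t < (p.2 : ℕ) ∨ (t = p.2 ∧ s < (p.1 : ℕ)) → a (s, t) = 0) →
      ρ (x p) (Finsupp.single a 1) = Finsupp.single (a + toExp p) (κ p) := by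
    intro p a ha
    show rep n hq h (x p : UqPlus n q) _ = _
    rw [hx, map_smul, LinearMap.smul_apply, rep_zRoot hq h p.1.isLt p.2.isLt a ha]
    simp [toExp]
  choose K hK using prod_raise hκ hy
  have e : φ ∘ mon x
      = fun e => K e • (Finsupp.single (∑ p, e p • toExp p) 1 : (ℕ × ℕ → ℤ) →₀ ℂ) := by
    funext e
    rw [← hK]
    show ρ (mon x e) _ = _
    rw [mon, orderedProd_eq, orderedProd_eq, map_list_prod, List.map_map]
    simp [Function.comp_def]
  rw [e]
  exact LinearIndependent.units_smul
    ((Finsupp.basisSingleOne (R := ℂ) (ι := ℕ × ℕ → ℤ)).linearIndependent.comp _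
      sum_toExp_injective) K

theorem linearIndependent_ZPow (hq : q ≠ 0) (h : q - q⁻¹ ≠ 0) :
    LinearIndependent ℂ (ZPow (n := n) q) :=
  linearIndependent_mon hq h (κ := fun _ => 1) (fun _ => one_ne_zero) fun p => by
    rw [one_smul, ← zEntry_eq p.1 p.1.isLt p.2 p.2.isLt]
    rfl

theorem linearIndependent_WPow (hq : q ≠ 0) (h : q - q⁻¹ ≠ 0) :
    LinearIndependent ℂ (WPow (n := n) q) :=
  linearIndependent_mon (S := AMinus n q) hq h (κ := fun p => (-q) ^ ((p.1 : ℕ) + p.2))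
    (fun _ => pow_ne_zero _ (neg_ne_zero.mpr hq)) fun p => by
    rw [← zEntry_eq p.1 p.1.isLt p.2 p.2.isLt, ← wEntry_eq hq]
    rfl

end Representation

/-! ### Matrix coefficients and separation of terms -/

section Separation

variable {n : ℕ} {q : ℂ} {V : Type*} [AddCommGroup V] [Module ℂ V]

/-- The pairing of an exponent vector with a multi-exponent. -/
def wt (e : Node n → ℤ) (a : Node n → ℕ) : ℤ := ∑ p, e p * (a p : ℤ)

theorem wt_add (e f : Node n → ℤ) (a : Node n → ℕ) : wt (e + f) a = wt e a + wt f a := by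
  simp [wt, add_mul, Finset.sum_add_distrib]

theorem wt_single (p : Node n) (c : ℤ) (a : Node n → ℕ) : wt (Pi.single p c) a = c * a p := by
  rw [wt, Finset.sum_eq_single p]
  · simp
  · intro r _ hr
    simp [Pi.single_eq_of_ne hr]
  · simp

theorem wt_add_single (e : Node n → ℤ) (a : Node n → ℕ) (p : Node n) :
    wt e (a + Pi.single p 1) = wt e a + e p := by
  have : ∀ r, e r * ((a + Pi.single p 1 : Node n → ℕ) r : ℤ)
      = e r * a r + if r = p then e r else 0 := by
    intro r
    by_cases h : r = p
    · subst h; simp [mul_add]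
    · simp [h]
  unfold wt
  rw [Finset.sum_congr rfl fun r _ => this r, Finset.sum_add_distrib]
  simp

theorem wt_sub (e : Node n → ℤ) (a a' : Node n → ℕ) :
    wt e a' = wt e a + ∑ p, e p * ((a' p : ℤ) - a p) := by
  rw [wt, wt, ← Finset.sum_add_distrib]
  exact Finset.sum_congr rfl fun p _ => by ring

variable (b : Module.Basis (Node n → ℕ) ℂ V)

/-- The matrix coefficients of an operator. -/
def coef (T : Module.End ℂ V) (a a' : Node n → ℕ) : ℂ := b.repr (T (b a)) a'

theorem coef_sub (S T : Module.End ℂ V) (a a' : Node n → ℕ) :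
    coef b (S - T) a a' = coef b S a a' - coef b T a a' := by
  simp [coef]

theorem coef_smul (c : ℂ) (T : Module.End ℂ V) (a a' : Node n → ℕ) :
    coef b (c • T) a a' = c * coef b T a a' := by
  simp [coef]

theorem ext_coef {S T : Module.End ℂ V} (h : ∀ a a', coef b S a a' = coef b T a a') : S = T :=
  b.ext fun a => b.repr.injective (Finsupp.ext fun a' => h a a')

theorem laurentH_apply (e : Node n → ℤ) (a : Node n → ℕ) :
    laurentH q b e (b a) = q ^ wt e a • b a := by
  rw [laurentH, Module.Basis.constr_basis]
  rfl

theorem repr_laurentH (e : Node n → ℤ) (v : V) (a : Node n → ℕ) :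
    b.repr (laurentH q b e v) a = q ^ wt e a * b.repr v a := by
  have : b.coord a ∘ₗ laurentH q b e = q ^ wt e a • b.coord a := by
    refine b.ext fun a' => ?_
    by_cases h : a' = a
    · subst h; simp [laurentH_apply]
    · simp [laurentH_apply, h]
  exact LinearMap.congr_fun this v

theorem coef_laurentH_mul (hq : q ≠ 0) (e f : Node n → ℤ) (T : Module.End ℂ V) (a a' : Node n → ℕ) :
    coef b (laurentH q b e * T * laurentH q b f) a a'
      = q ^ (wt e a' + wt f a) * coef b T a a' := by
  rw [coef, Module.End.mul_apply, Module.End.mul_apply, repr_laurentH, laurentH_apply, map_smul,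
    map_smul, Finsupp.smul_apply, smul_eq_mul, zpow_add₀ hq, coef]
  ring

/-- `T` shifts exponents by `δ` with coefficient a nonzero constant times `q ^ wt e a * g a`, up to
matrix coefficients whose indices satisfy `P`. -/
def HasLead (q : ℂ) (δ : Node n → ℤ) (g : (Node n → ℕ) → ℂ) (e : Node n → ℤ)
    (P : (Node n → ℕ) → (Node n → ℕ) → Prop) (T : Module.End ℂ V) : Prop :=
  ∃ c : ℂ, c ≠ 0 ∧
    (∀ a a' : Node n → ℕ, (∀ p, (a' p : ℤ) - a p = δ p) →
      coef b T a a' = c * (q ^ wt e a * g a)) ∧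
    ∀ a a' : Node n → ℕ, coef b T a a' ≠ 0 → (∀ p, (a' p : ℤ) - a p = δ p) ∨ P a a'

/-- The combination `H T H' - q^{-2ε} H' T H`, where `H' = H · (H_p)^2`, kills the terms of `T`
that change the exponent at `p` by `ε` and rescales those that do not change it. -/
theorem HasLead.separate (hq : q ≠ 0) {D : Subalgebra ℂ (Module.End ℂ V)} {δ : Node n → ℤ}
    {g : (Node n → ℕ) → ℂ} {ε : ℤ} (hε : q ^ (-(2 * ε)) ≠ 1) (h : Node n → Node n → ℤ)
    (l : List (Node n)) (hl : ∀ p ∈ l, δ p = 0) (hH : ∀ p ∈ l, laurentH q b (h p) ∈ D)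
    (hH' : ∀ p ∈ l, laurentH q b (h p + Pi.single p 2) ∈ D) {e : Node n → ℤ}
    {T : Module.End ℂ V} (hT : T ∈ D)
    (hlead : HasLead b q δ g e (fun a a' => ∃ p ∈ l, (a' p : ℤ) - a p = ε) T) :
    ∃ T' ∈ D, HasLead b q δ g (e + (l.map fun p => h p + (h p + Pi.single p 2)).sum)
      (fun _ _ => False) T' := by
  induction l generalizing e T with
  | nil => exact ⟨T, hT, by simpa using hlead⟩
  | cons p l ih =>
    obtain ⟨c, hc, h1, h2⟩ := hlead
    have hcoef : ∀ a a', coef b (laurentH q b (h p) * T * laurentH q b (h p + Pi.single p 2)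
          - q ^ (-(2 * ε)) • (laurentH q b (h p + Pi.single p 2) * T * laurentH q b (h p))) a a'
        = q ^ (wt (h p) a' + wt (h p) a + 2 * a p)
          * (1 - q ^ (2 * ((a' p : ℤ) - a p) - 2 * ε)) * coef b T a a' := by
      intro a a'
      rw [coef_sub, coef_smul, coef_laurentH_mul b hq,
        coef_laurentH_mul b hq, wt_add, wt_add, wt_single, wt_single,
        mul_sub, mul_one, sub_mul, ← zpow_add₀ hq, ← mul_assoc, ← zpow_add₀ hq]
      congr 3 <;> ring_nf
    have := ih (fun r hr => hl r (by simp [hr])) (fun r hr => hH r (by simp [hr]))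
      (fun r hr => hH' r (by simp [hr])) (e := e + (h p + (h p + Pi.single p 2)))
      (D.sub_mem (D.mul_mem (D.mul_mem (hH p (by simp)) hT) (hH' p (by simp)))
        (D.smul_mem (D.mul_mem (D.mul_mem (hH' p (by simp)) hT) (hH p (by simp)))
          (q ^ (-(2 * ε))))) ?_
    · simpa only [List.map_cons, List.sum_cons, add_assoc] using this
    · refine ⟨c * (q ^ (∑ r, h p r * δ r) * (1 - q ^ (-(2 * ε)))),
        mul_ne_zero hc (mul_ne_zero (zpow_ne_zero _ hq) (sub_ne_zero.mpr hε.symm)), ?_, ?_⟩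
      · intro a a' ha
        rw [hcoef, h1 a a' ha, wt_sub (h p) a a', ha p, hl p (by simp)]
        have e1 : ∑ r, h p r * ((a' r : ℤ) - a r) = ∑ r, h p r * δ r :=
          Finset.sum_congr rfl fun r _ => by rw [ha]
        rw [e1, wt_add, wt_add, wt_add, wt_single, mul_zero, zero_sub]
        simp only [zpow_add₀ hq]
        ring
      · intro a a' hne
        rw [hcoef] at hne
        rcases h2 a a' (right_ne_zero_of_mul hne) with h3 | ⟨r, hr, h3⟩
        · exact Or.inl h3
        · right
          rcases List.mem_cons.mp hr with rfl | hr
          · exact absurd (by rw [h3, sub_self, zpow_zero, sub_self, mul_zero, zero_mul]) hne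
          · exact ⟨r, hr, h3⟩

theorem shift_eq_single {p : Node n} {a a' : Node n → ℕ} :
    (∀ r, (a' r : ℤ) - a r = (Pi.single p 1 : Node n → ℤ) r) ↔ a' = a + Pi.single p 1 := by
  constructor
  · intro h
    funext r
    have := h r
    by_cases hr : r = p
    · subst hr
      simp at this ⊢
      omega
    · simp [hr] at this ⊢
      omega
  · rintro rfl r
    by_cases hr : r = p
    · subst hr; simp
    · simp [hr]

theorem shift_eq_neg_single {p : Node n} {a a' : Node n → ℕ} :
    (∀ r, (a' r : ℤ) - a r = (-Pi.single p 1 : Node n → ℤ) r) ↔ a = a' + Pi.single p 1 := by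
  rw [← shift_eq_single]
  refine forall_congr' fun r => ?_
  rw [Pi.neg_apply, ← neg_eq_iff_eq_neg, neg_sub]

theorem coef_laurentH_opM (hq : q ≠ 0) (e : Node n → ℤ) (p : Node n) (a a' : Node n → ℕ) :
    coef b (laurentH q b e * opM b p) a a'
      = if a' = a + Pi.single p 1 then q ^ e p * q ^ wt e a else 0 := by
  rw [coef, Module.End.mul_apply, opM, Module.Basis.constr_basis, laurentH_apply, map_smul,
    Module.Basis.repr_self, Finsupp.smul_single, Finsupp.single_apply, wt_add_single,
    zpow_add₀ hq, smul_eq_mul, mul_one, mul_comm]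
  simp only [eq_comm]

theorem qInt_zero : qInt q 0 = 0 := by simp [qInt]

theorem laurentH_opD_apply (e : Node n → ℤ) (p : Node n) (a : Node n → ℕ) :
    (laurentH q b e * opD q b p) (b (a + Pi.single p 1))
      = (q ^ wt e a * qInt q (a p + 1)) • b a := by
  have : a + Pi.single p 1 - Pi.single p 1 = a := add_tsub_cancel_right _ _
  rw [Module.End.mul_apply, opD, Module.Basis.constr_basis, map_smul, this, laurentH_apply,
    smul_smul, mul_comm]
  simp

theorem opD_apply_of_eq_zero (p : Node n) {a : Node n → ℕ} (ha : a p = 0) :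
    opD q b p (b a) = 0 := by
  rw [opD, Module.Basis.constr_basis, ha, qInt_zero, zero_smul]

theorem exists_eq_add_single {p : Node n} {a : Node n → ℕ} (ha : a p ≠ 0) :
    ∃ a' : Node n → ℕ, a = a' + Pi.single p 1 := by
  refine ⟨a - Pi.single p 1, (tsub_add_cancel_of_le ?_).symm⟩
  intro r
  by_cases hr : r = p
  · subst hr
    simpa using Nat.one_le_iff_ne_zero.mpr ha
  · simp [hr]

theorem coef_laurentH_opD (hq : q ≠ 0) (e : Node n → ℤ) (p : Node n) (a a' : Node n → ℕ) :
    coef b (laurentH q b e * opD q b p) a a'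
      = if a = a' + Pi.single p 1 then q ^ (-e p) * (q ^ wt e a * qInt q (a p)) else 0 := by
  by_cases ha : a p = 0
  · rw [coef, Module.End.mul_apply, opD_apply_of_eq_zero b p ha, ha, qInt_zero]
    simp
  · obtain ⟨c, rfl⟩ := exists_eq_add_single ha
    rw [coef, laurentH_opD_apply b, map_smul, Module.Basis.repr_self, Finsupp.smul_single,
      Finsupp.single_apply, wt_add_single]
    simp only [add_left_inj, smul_eq_mul, mul_one]
    refine if_congr Iff.rfl ?_ rfl
    rw [← mul_assoc, ← zpow_add₀ hq]
    simp

theorem HasLead.mem_opM (hq : q ≠ 0) {D : Subalgebra ℂ (Module.End ℂ V)} {e : Node n → ℤ}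
    {p : Node n} {T : Module.End ℂ V} (hT : T ∈ D)
    (h : HasLead b q (Pi.single p 1) (fun _ => 1) e (fun _ _ => False) T) :
    laurentH q b e * opM b p ∈ D := by
  obtain ⟨c, hc, h1, h2⟩ := h
  have : laurentH q b e * opM b p = (c⁻¹ * q ^ e p) • T := by
    refine ext_coef b fun a a' => ?_
    rw [coef_laurentH_opM b hq, coef_smul]
    split_ifs with h
    · rw [h1 a a' (shift_eq_single.mpr h)]
      field_simp
    · by_contra hne
      refine h ((h2 a a' fun h0 => hne ?_).elim shift_eq_single.mp False.elim)
      rw [h0, mul_zero]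
  rw [this]
  exact D.smul_mem hT _

theorem HasLead.mem_opD (hq : q ≠ 0) {D : Subalgebra ℂ (Module.End ℂ V)} {e : Node n → ℤ}
    {p : Node n} {T : Module.End ℂ V} (hT : T ∈ D)
    (h : HasLead b q (-Pi.single p 1) (fun a => qInt q (a p)) e (fun _ _ => False) T) :
    laurentH q b e * opD q b p ∈ D := by
  obtain ⟨c, hc, h1, h2⟩ := h
  have : laurentH q b e * opD q b p = (c⁻¹ * q ^ (-e p)) • T := by
    refine ext_coef b fun a a' => ?_
    rw [coef_laurentH_opD b hq, coef_smul]
    split_ifs with h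
    · rw [h1 a a' (shift_eq_neg_single.mpr h)]
      field_simp
    · by_contra hne
      refine h ((h2 a a' fun h0 => hne ?_).elim shift_eq_neg_single.mp False.elim)
      rw [h0, mul_zero]
  rw [this]
  exact D.smul_mem hT _

theorem qInt_eq (h : q - q⁻¹ ≠ 0) (hq : q ≠ 0) (m : ℕ) : qInt q m = qNum q m := by
  rw [qNum, eq_div_iff h, qInt, Finset.sum_mul]
  have := Finset.sum_range_sub (fun k : ℕ => q ^ (2 * (k : ℤ) - m)) m
  rw [show (2 * (m : ℤ) - m) = m by ring, show 2 * ((0 : ℕ) : ℤ) - m = -m by simp] at this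
  rw [← this]
  refine Finset.sum_congr rfl fun k _ => ?_
  rw [mul_sub, ← zpow_add_one₀ hq, ← zpow_sub_one₀ hq]
  congr 2
  · push_cast; ring
  · ring

theorem qInt_succ_sub (h : q - q⁻¹ ≠ 0) (hq : q ≠ 0) (m : ℕ) :
    qInt q (m + 1) - q * qInt q m = q ^ (-(m : ℤ)) ∧
      qInt q (m + 1) - q⁻¹ * qInt q m = q ^ (m : ℤ) := by
  have e1 : qInt q (m + 1) = qNum q ((m : ℤ) + 1) := by rw [qInt_eq h hq]; norm_cast
  rw [e1, qInt_eq h hq]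
  unfold qNum
  rw [neg_add, zpow_add_one₀ hq, zpow_add₀ hq, zpow_neg_one]
  constructor
  · rw [mul_div_assoc', ← sub_div, div_eq_iff h]
    ring
  · rw [mul_div_assoc', ← sub_div, div_eq_iff h]
    ring

/-- From multiples of `M_p` and `D_p` by Laurent monomials one gets two Laurent monomials that
differ by the square of `H_p`. -/
theorem laurentH_mem (h : q - q⁻¹ ≠ 0) (hq : q ≠ 0) {D : Subalgebra ℂ (Module.End ℂ V)}
    {p : Node n} {e f : Node n → ℤ} (hM : laurentH q b e * opM b p ∈ D)
    (hD : laurentH q b f * opD q b p ∈ D) :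
    laurentH q b (e + f - Pi.single p 1) ∈ D ∧
      laurentH q b (e + f - Pi.single p 1 + Pi.single p 2) ∈ D := by
  have hMa : ∀ a, (laurentH q b e * opM b p) (b a)
      = (q ^ e p * q ^ wt e a) • b (a + Pi.single p 1) := fun a => by
    rw [Module.End.mul_apply, opM, Module.Basis.constr_basis, laurentH_apply, wt_add_single,
      zpow_add₀ hq, mul_comm]
  have hDM : ∀ a, ((laurentH q b f * opD q b p) * (laurentH q b e * opM b p)) (b a)
      = (q ^ e p * (q ^ wt (e + f) a * qInt q (a p + 1))) • b a := fun a => by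
    rw [Module.End.mul_apply, hMa, map_smul, laurentH_opD_apply b, smul_smul, wt_add,
      zpow_add₀ hq]
    congr 1
    ring
  have hMD : ∀ a, ((laurentH q b e * opM b p) * (laurentH q b f * opD q b p)) (b a)
      = (q ^ (-f p) * (q ^ wt (e + f) a * qInt q (a p))) • b a := fun a => by
    by_cases ha : a p = 0
    · rw [Module.End.mul_apply, Module.End.mul_apply (laurentH q b f),
        opD_apply_of_eq_zero b p ha, ha, qInt_zero]
      simp
    · obtain ⟨c, rfl⟩ := exists_eq_add_single ha
      rw [Module.End.mul_apply, laurentH_opD_apply b, map_smul, hMa, smul_smul, wt_add,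
        wt_add_single, wt_add_single]
      congr 1
      simp only [zpow_add₀ hq, zpow_neg, Pi.add_apply, Pi.single_eq_same]
      field_simp
  have key : ∀ x : ℂ, q ^ (-e p) • ((laurentH q b f * opD q b p) * (laurentH q b e * opM b p))
      - (x * q ^ f p) • ((laurentH q b e * opM b p) * (laurentH q b f * opD q b p)) ∈ D :=
    fun x => D.sub_mem (D.smul_mem (D.mul_mem hD hM) _) (D.smul_mem (D.mul_mem hM hD) _)
  have val : ∀ (x : ℂ) (a : Node n → ℕ),
      (q ^ (-e p) • ((laurentH q b f * opD q b p) * (laurentH q b e * opM b p))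
      - (x * q ^ f p) • ((laurentH q b e * opM b p) * (laurentH q b f * opD q b p))) (b a)
      = (q ^ wt (e + f) a * (qInt q (a p + 1) - x * qInt q (a p))) • b a := fun x a => by
    rw [LinearMap.sub_apply, LinearMap.smul_apply, LinearMap.smul_apply, hDM, hMD, smul_smul,
      smul_smul, ← sub_smul]
    congr 1
    simp only [zpow_neg]
    field_simp
  constructor
  · convert key q using 1
    refine b.ext fun a => ?_
    rw [val, laurentH_apply, (qInt_succ_sub h hq _).1, ← zpow_add₀ hq, sub_eq_add_neg,
      ← Pi.single_neg, wt_add _ (Pi.single p (-1)), wt_single, neg_one_mul]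
  · convert key q⁻¹ using 1
    refine b.ext fun a => ?_
    have e1 : e + f - Pi.single p 1 + Pi.single p 2 = e + f + Pi.single p 1 := by
      rw [sub_add_eq_add_sub, add_sub_assoc, ← Pi.single_sub]
      norm_num
    rw [val, laurentH_apply, (qInt_succ_sub h hq _).2, ← zpow_add₀ hq, e1, wt_add _ (Pi.single p 1),
      wt_single, one_mul]

theorem repr_of_sub_mem_span {v : V} {c : ℂ} {a₀ : Node n → ℕ} {P : (Node n → ℕ) → Prop}
    (h : v - c • b a₀ ∈ Submodule.span ℂ {w | ∃ a, w = b a ∧ P a}) :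
    (¬ P a₀ → b.repr v a₀ = c) ∧ ∀ a, b.repr v a ≠ 0 → a = a₀ ∨ P a := by
  have key : ∀ a, ¬ P a → b.repr v a = c * b.repr (b a₀) a := by
    intro a ha
    have hle : Submodule.span ℂ {w | ∃ a, w = b a ∧ P a} ≤ LinearMap.ker (b.coord a) := by
      refine Submodule.span_le.mpr ?_
      rintro _ ⟨a', rfl, ha'⟩
      have : a' ≠ a := fun e => ha (e ▸ ha')
      simp [this]
    have := LinearMap.mem_ker.mp (hle h)
    rw [map_sub, map_smul, sub_eq_zero] at this
    exact this
  refine ⟨fun h0 => by rw [key _ h0]; simp, fun a hne => ?_⟩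
  by_contra! hcon
  refine hne ?_
  rw [key a hcon.2, Module.Basis.repr_self, Finsupp.single_eq_of_ne hcon.1, mul_zero]

end Separation

/-! ### The operators dual to right multiplication -/

section Derivatives

variable {n : ℕ} {q : ℂ}

/-- `q` is nonzero and not a root of unity. -/
def Generic (q : ℂ) : Prop := q ≠ 0 ∧ ∀ k : ℕ, 0 < k → q ^ k ≠ 1

theorem Generic.one_add_sq_ne (h : Generic q) : 1 + q ^ 2 ≠ 0 := fun h0 =>
  h.2 4 (by norm_num) (by linear_combination (q ^ 2 - 1) * h0)

theorem Generic.sub_inv_ne (h : Generic q) : q - q⁻¹ ≠ 0 := fun h0 =>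
  h.2 2 (by norm_num) (by
    have := h.1
    field_simp at h0
    linear_combination h0)

theorem Generic.zpow_ne (h : Generic q) {m : ℤ} (hm : m ≠ 0) : q ^ m ≠ 1 := by
  intro h0
  rcases Int.natAbs_eq m with e | e
  · rw [e, zpow_natCast] at h0
    exact h.2 _ (Int.natAbs_pos.mpr hm) h0
  · rw [e, zpow_neg, inv_eq_one, zpow_natCast] at h0
    exact h.2 _ (Int.natAbs_pos.mpr hm) h0

/-- The basis of ordered monomials of `𝒜_q^+`. -/
def zBasis (n : ℕ) (h : Generic q) : Module.Basis (Node n → ℕ) ℂ (APlus n q) :=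
  Module.Basis.mk (linearIndependent_ZPow h.1 h.sub_inv_ne) (span_ZPow h.1 h.one_add_sq_ne)

/-- The basis of ordered monomials of `𝒜_q^-`. -/
def wBasis (n : ℕ) (h : Generic q) : Module.Basis (Node n → ℕ) ℂ (AMinus n q) :=
  Module.Basis.mk (linearIndependent_WPow h.1 h.sub_inv_ne) (span_WPow h.1 h.one_add_sq_ne)

theorem zBasis_apply (h : Generic q) (a : Node n → ℕ) : zBasis n h a = ZPow q a :=
  Module.Basis.mk_apply _ _ _

theorem wBasis_apply (h : Generic q) (a : Node n → ℕ) : wBasis n h a = WPow q a :=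
  Module.Basis.mk_apply _ _ _

/-- The scaling of `U_q^-` that doubles `F_β` and fixes the compact root vectors. It multiplies
`W^a` by `2 ^ |a|`, and so detects the degree. -/
def scaleBeta (n : ℕ) (q : ℂ) : UqMinus n q →ₐ[ℂ] UqMinus n q :=
  RingQuot.liftAlgHom ℂ ⟨FreeAlgebra.lift ℂ fun
    | .beta => (2 : ℂ) • F q .beta
    | .mu k => F q (.mu k)
    | .nu k => F q (.nu k), fun x y hxy => by
      have key : ∀ a : SimpleRoot n, ∃ c : ℂ, (match a with
          | .beta => (2 : ℂ) • F q .beta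
          | .mu k => F q (.mu k)
          | .nu k => F q (.nu k) : UqMinus n q) = c • F q a := by
        rintro (_ | k | k)
        exacts [⟨2, rfl⟩, ⟨1, (one_smul _ _).symm⟩, ⟨1, (one_smul _ _).symm⟩]
      cases hxy with
      | comm a b hab =>
        obtain ⟨c, hc⟩ := key a
        obtain ⟨d, hd⟩ := key b
        have := (E_commute (q := q) hab).eq
        simp only [map_mul, FreeAlgebra.lift_ι_apply, hc, hd, smul_mul_smul_comm]
        rw [show F q a * F q b = F q b * F q a from this, mul_comm c d]
      | serre a b hab =>
        obtain ⟨c, hc⟩ := key a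
        obtain ⟨d, hd⟩ := key b
        have := E_serre (q := q) hab
        unfold Serre at this
        simp only [map_mul, map_add, map_smul, FreeAlgebra.lift_ι_apply, hc, hd,
          smul_mul_smul_comm]
        rw [mul_comm d c, mul_right_comm c d c, ← smul_add, smul_comm (q + q⁻¹)]
        exact congrArg _ this⟩

theorem scaleBeta_wEntry (i : ℕ) (hi : i < n) (j : ℕ) (hj : j < n) :
    scaleBeta n q (wEntry q i hi j hj) = (2 : ℂ) • wEntry q i hi j hj := by
  have hmu : ∀ k, scaleBeta n q (F q (.mu k)) = F q (.mu k) := fun k => by simp [scaleBeta, F]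
  have hnu : ∀ k, scaleBeta n q (F q (.nu k)) = F q (.nu k) := fun k => by simp [scaleBeta, F]
  have hb : scaleBeta n q (F q .beta) = (2 : ℂ) • F q .beta := by simp [scaleBeta, F]
  induction j with
  | zero =>
    rw [wEntry]
    induction i with
    | zero => exact hb
    | succ i ih =>
      rw [wCol, map_sub, map_smul, map_mul, map_mul, ih (by omega), hmu, smul_mul_assoc,
        mul_smul_comm, smul_sub, smul_comm q]
  | succ j ih =>
    rw [wEntry, map_sub, map_smul, map_mul, map_mul, ih (by omega), hnu, smul_mul_assoc,
      mul_smul_comm, smul_sub, smul_comm q]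

theorem scaleBeta_WPow (a : Node n → ℕ) :
    scaleBeta n q (WPow q a : AMinus n q) = (2 : ℂ) ^ (∑ p, a p) • (WPow q a : UqMinus n q) := by
  have e : (WPow q a : UqMinus n q)
      = ((nodeList n).map fun p => wEntry q p.1 p.1.isLt p.2 p.2.isLt ^ a p).prod := by
    rw [WPow, orderedProd_eq]
    show (AMinus n q).val _ = _
    rw [map_list_prod, List.map_map]
    rfl
  rw [e, ← sum_nodeList]
  induction nodeList n with
  | nil => simp
  | cons p l ih =>
    rw [List.map_cons, List.prod_cons, map_mul, ih, map_pow, scaleBeta_wEntry, smul_pow,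
      smul_mul_smul_comm, List.map_cons, List.sum_cons, pow_add]

/-- The matrix coefficients of right multiplication by `W_p`. -/
def wCoef (h : Generic q) (p : Node n) (a a' : Node n → ℕ) : ℂ :=
  (wBasis n h).repr (wBasis n h a * W q p) a'

/-- Multiplication by `W_p` raises the total degree by one. -/
theorem degree_of_wCoef_ne_zero (h : Generic q) {p : Node n} {a a' : Node n → ℕ}
    (hne : wCoef h p a a' ≠ 0) : ∑ r, a' r = ∑ r, a r + 1 := by
  let S : AMinus n q →ₗ[ℂ] AMinus n q :=
    (wBasis n h).constr ℂ fun a => (2 : ℂ) ^ (∑ r, a r) • wBasis n h a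
  have hS : ∀ v : AMinus n q, ((S v : AMinus n q) : UqMinus n q) = scaleBeta n q v := by
    have : (AMinus n q).val.toLinearMap ∘ₗ S
        = (scaleBeta n q).toLinearMap ∘ₗ (AMinus n q).val.toLinearMap := by
      refine (wBasis n h).ext fun a => ?_
      have e : S (wBasis n h a) = (2 : ℂ) ^ (∑ r, a r) • wBasis n h a :=
        Module.Basis.constr_basis _ _ _ _
      rw [LinearMap.comp_apply, e, map_smul, wBasis_apply]
      exact (scaleBeta_WPow a).symm
    exact fun v => LinearMap.congr_fun this v
  have hrepr : ∀ v, (wBasis n h).repr (S v) a' = 2 ^ (∑ r, a' r) * (wBasis n h).repr v a' := by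
    intro v
    have : (wBasis n h).coord a' ∘ₗ S = (2 : ℂ) ^ (∑ r, a' r) • (wBasis n h).coord a' := by
      refine (wBasis n h).ext fun c => ?_
      by_cases hc : c = a'
      · subst hc; simp [S]
      · simp [S, hc]
    exact LinearMap.congr_fun this v
  have hval : S (wBasis n h a * W q p)
      = (2 : ℂ) ^ (∑ r, a r + 1) • (wBasis n h a * W q p) := by
    refine Subtype.ext ?_
    rw [hS]
    show scaleBeta n q ((wBasis n h a : UqMinus n q) * (W q p : UqMinus n q))
      = (2 : ℂ) ^ (∑ r, a r + 1) • ((wBasis n h a : UqMinus n q) * (W q p : UqMinus n q))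
    rw [map_mul, wBasis_apply, scaleBeta_WPow, W, scaleBeta_wEntry, smul_mul_smul_comm, pow_succ]
  have e1 := hrepr (wBasis n h a * W q p)
  rw [hval, map_smul, Finsupp.smul_apply, smul_eq_mul] at e1
  have e2 := mul_right_cancel₀ hne e1
  have e3 : (2 : ℕ) ^ (∑ r, a r + 1) = 2 ^ (∑ r, a' r) := by exact_mod_cast e2
  exact (Nat.pow_right_injective le_rfl e3).symm

/-- The exponent in `[a]_X = q^{ε (a - 1)} [a]_q`. -/
def Pairing.twist : Pairing → ℤ
  | .J => 1
  | .K => -1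
  | .L => 0

theorem Pairing.int_succ (hq : q ≠ 0) (X : Pairing) (m : ℕ) :
    X.int q (m + 1) = q ^ (X.twist * m) * qInt q (m + 1) := by
  cases X with
  | J =>
    simp only [Pairing.int, Pairing.twist, qInt, Finset.mul_sum, ← zpow_add₀ hq]
    refine Finset.sum_congr rfl fun k _ => ?_
    congr 1
    push_cast
    ring
  | K =>
    simp only [Pairing.int, Pairing.twist, qInt]
    rw [← Finset.sum_range_reflect, Finset.mul_sum]
    refine Finset.sum_congr rfl fun k hk => ?_
    have hk := Finset.mem_range.mp hk
    rw [← zpow_add₀ hq]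
    congr 1
    push_cast [Nat.cast_sub (show k ≤ m by omega), Nat.cast_sub (show 1 ≤ m + 1 by omega),
      show m + 1 - 1 - k = m - k by omega]
    ring
  | L => simp [Pairing.int, Pairing.twist]

theorem qInt_succ_ne_zero (h : Generic q) (m : ℕ) : qInt q (m + 1) ≠ 0 := by
  rw [qInt_eq h.sub_inv_ne h.1, qNum]
  refine div_ne_zero (sub_ne_zero.mpr fun e => ?_) h.sub_inv_ne
  refine h.zpow_ne (m := 2 * ((m + 1 : ℕ) : ℤ)) (by omega) ?_
  rw [two_mul, zpow_add₀ h.1]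
  nth_rewrite 1 [e]
  rw [← zpow_add₀ h.1, neg_add_cancel, zpow_zero]

/-- The value of the pairing on a pair of monomials with equal exponents. -/
def pairNorm (q : ℂ) (X : Pairing) (a : Node n → ℕ) : ℂ :=
  (-1 / (q - q⁻¹)) ^ (∑ p, a p) * ∏ p, X.factorial q (a p)

theorem pairNorm_ne_zero (h : Generic q) (X : Pairing) (a : Node n → ℕ) :
    pairNorm q X a ≠ 0 := by
  refine mul_ne_zero (pow_ne_zero _ (div_ne_zero (neg_ne_zero.mpr one_ne_zero) h.sub_inv_ne))
    (Finset.prod_ne_zero_iff.mpr fun p _ => Finset.prod_ne_zero_iff.mpr fun k _ => ?_)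
  rw [Pairing.int_succ h.1]
  exact mul_ne_zero (zpow_ne_zero _ h.1) (qInt_succ_ne_zero h k)

theorem pairNorm_add_single (X : Pairing) (a : Node n → ℕ) (p : Node n) :
    pairNorm q X (a + Pi.single p 1)
      = pairNorm q X a * (-1 / (q - q⁻¹) * X.int q (a p + 1)) := by
  have e : ∀ r, X.factorial q ((a + Pi.single p 1 : Node n → ℕ) r)
      = X.factorial q (a r) * if r = p then X.int q (a p + 1) else 1 := by
    intro r
    by_cases hr : r = p
    · subst hr
      simp [Pairing.factorial, Finset.prod_range_succ]
    · simp [hr]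
  rw [pairNorm, pairNorm, Finset.prod_congr rfl fun r _ => e r, Finset.prod_mul_distrib,
    Finset.prod_ite_eq' _ p fun _ => X.int q (a p + 1)]
  simp [Finset.sum_add_distrib, pow_succ]
  ring

theorem pairing_basis (X : Pairing) (bZ : Module.Basis (Node n → ℕ) ℂ (APlus n q))
    (bW : Module.Basis (Node n → ℕ) ℂ (AMinus n q)) (a : Node n → ℕ) (v : AMinus n q) :
    pairing q X bZ bW (bZ a) v = pairNorm q X a * bW.repr v a := by
  have : pairing q X bZ bW (bZ a) = pairNorm q X a • bW.coord a := by
    refine bW.ext fun c => ?_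
    rw [pairing, Module.Basis.constr_basis, Module.Basis.constr_basis]
    by_cases hc : a = c
    · subst hc; simp [pairNorm]
    · simp [hc]
  rw [this]
  rfl

/-- The operator `∂/∂Z_p` dual to right multiplication by `W_p`: in the bases of monomials its
matrix is the transpose of that of the multiplication, rescaled by the norms of the monomials.
Each sum is finite because the multiplication raises the degree by one. -/
def partialZ (X : Pairing) (h : Generic q) (p : Node n) : Module.End ℂ (APlus n q) :=
  (zBasis n h).constr ℂ fun a => ∑ c ∈ Finset.piAntidiag Finset.univ (∑ r, a r - 1),
    ((pairNorm q X c)⁻¹ * pairNorm q X a * wCoef h p c a) • zBasis n h c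

theorem coef_partialZ (X : Pairing) (h : Generic q) (p : Node n) (a a' : Node n → ℕ) :
    coef (V := APlus n q) (zBasis n h) (partialZ X h p) a a'
      = (pairNorm q X a')⁻¹ * pairNorm q X a * wCoef h p a' a := by
  rw [coef, partialZ, Module.Basis.constr_basis, map_sum, Finsupp.finsetSum_apply]
  simp only [map_smul, Module.Basis.repr_self, Finsupp.smul_single, Finsupp.single_apply,
    smul_eq_mul, mul_one, Finset.sum_ite_eq']
  split_ifs with hmem
  · rfl
  · by_contra hne
    have := degree_of_wCoef_ne_zero h (right_ne_zero_of_mul (Ne.symm hne))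
    exact hmem (by simp [Finset.mem_piAntidiag, this])

theorem isPartial_partialZ (X : Pairing) (h : Generic q) (p : Node n) :
    IsPartial q X (zBasis n h) (wBasis n h) p (partialZ X h p) := by
  intro u v
  have h1 : ∀ a, (pairing q X (zBasis n h) (wBasis n h) (partialZ X h p (zBasis n h a)))
      = (pairing q X (zBasis n h) (wBasis n h) (zBasis n h a)) ∘ₗ
        LinearMap.mulRight ℂ (W q p) := by
    intro a
    refine (wBasis n h).ext fun c => ?_
    have h2 : ∀ w, pairing q X (zBasis n h) (wBasis n h) w (wBasis n h c)
        = pairNorm q X c * (zBasis n h).repr w c := by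
      intro w
      have : (pairing q X (zBasis n h) (wBasis n h)).flip (wBasis n h c)
          = pairNorm q X c • (zBasis n h).coord c := by
        refine (zBasis n h).ext fun d => ?_
        rw [LinearMap.flip_apply, pairing_basis]
        by_cases hd : d = c
        · subst hd; simp
        · simp [hd, Ne.symm hd]
      exact LinearMap.congr_fun this w
    have h3 := coef_partialZ X h p a c
    rw [coef] at h3
    rw [h2, h3, LinearMap.comp_apply, LinearMap.mulRight_apply, pairing_basis, wCoef]
    have := pairNorm_ne_zero h X c
    field_simp
  have h2 : (pairing q X (zBasis n h) (wBasis n h)).flip v ∘ₗ partialZ X h p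
      = (pairing q X (zBasis n h) (wBasis n h)).flip (v * W q p) := by
    refine (zBasis n h).ext fun a => ?_
    exact LinearMap.congr_fun (h1 a) v
  exact LinearMap.congr_fun h2 u

/-! ### Leading terms of the generators -/

theorem hasLead_mulLeft (h : Generic q) (i j : Fin n) :
    HasLead (V := APlus n q) (zBasis n h) q (Pi.single (i, j) 1) (fun _ => 1) (leftExp i j)
      (fun a a' => ∃ p ∈ ((List.finRange n).filter (· < i)).map (fun s => (s, j)),
        (a' p : ℤ) - a p = 1) (mulZ q .left (i, j)) := by
  have key : ∀ a, _ := fun a => repr_of_sub_mem_span (V := APlus n q) (zBasis n h)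
    (v := Z q (i, j) * ZPow q a)
    (a₀ := a + Pi.single (i, j) 1) (c := q ^ wt (leftExp i j) a)
    (P := fun c => ∃ s < i, c (s, j) = a (s, j) + 1) (by
      simp only [zBasis_apply]
      exact (quantumMatrix_Z h.1 h.one_add_sq_ne).entry_mul_mon i j a)
  have hcoef : ∀ a a', coef (V := APlus n q) (zBasis n h) (mulZ q .left (i, j)) a a'
      = (zBasis n h).repr (Z q (i, j) * ZPow q a) a' := fun a a' => by
    rw [coef, zBasis_apply]
    rfl
  refine ⟨1, one_ne_zero, fun a a' ha => ?_, fun a a' hne => ?_⟩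
  · rw [shift_eq_single.mp ha, hcoef, (key a).1, one_mul, mul_one]
    rintro ⟨s, hs, h1⟩
    simp [hs.ne] at h1
  · rw [hcoef] at hne
    rcases (key a).2 a' hne with h1 | ⟨s, hs, h1⟩
    · exact Or.inl (shift_eq_single.mpr h1)
    · exact Or.inr ⟨(s, j), by simpa using hs, by rw [h1]; push_cast; ring⟩

theorem hasLead_mulRight (h : Generic q) (i j : Fin n) :
    HasLead (V := APlus n q) (zBasis n h) q (Pi.single (i, j) 1) (fun _ => 1) (rightExp i j)
      (fun a a' => ∃ p ∈ ((List.finRange n).filter (j < ·)).map (fun t => (i, t)),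
        (a' p : ℤ) - a p = 1) (mulZ q .right (i, j)) := by
  have key : ∀ a, _ := fun a => repr_of_sub_mem_span (V := APlus n q) (zBasis n h)
    (v := ZPow q a * Z q (i, j))
    (a₀ := a + Pi.single (i, j) 1) (c := q ^ wt (rightExp i j) a)
    (P := fun c => ∃ t > j, c (i, t) = a (i, t) + 1) (by
      simp only [zBasis_apply]
      exact (quantumMatrix_Z h.1 h.one_add_sq_ne).mon_mul_entry i j a)
  have hcoef : ∀ a a', coef (V := APlus n q) (zBasis n h) (mulZ q .right (i, j)) a a'
      = (zBasis n h).repr (ZPow q a * Z q (i, j)) a' := fun a a' => by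
    rw [coef, zBasis_apply]
    rfl
  refine ⟨1, one_ne_zero, fun a a' ha => ?_, fun a a' hne => ?_⟩
  · rw [shift_eq_single.mp ha, hcoef, (key a).1, one_mul, mul_one]
    rintro ⟨t, ht, h1⟩
    simp [ht.ne'] at h1
  · rw [hcoef] at hne
    rcases (key a).2 a' hne with h1 | ⟨t, ht, h1⟩
    · exact Or.inl (shift_eq_single.mpr h1)
    · exact Or.inr ⟨(i, t), by simpa using ht, by rw [h1]; push_cast; ring⟩

theorem hasLead_partialZ (X : Pairing) (h : Generic q) (i j : Fin n) :
    HasLead (V := APlus n q) (zBasis n h) q (-Pi.single (i, j) 1) (fun a => qInt q (a (i, j)))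
      (rightExp i j + Pi.single (i, j) X.twist)
      (fun a a' => ∃ p ∈ ((List.finRange n).filter (j < ·)).map (fun t => (i, t)),
        (a' p : ℤ) - a p = -1) (partialZ X h (i, j)) := by
  have key : ∀ a, _ := fun a => repr_of_sub_mem_span (V := AMinus n q) (wBasis n h)
    (v := WPow q a * W q (i, j))
    (a₀ := a + Pi.single (i, j) 1) (c := q ^ wt (rightExp i j) a)
    (P := fun c => ∃ t > j, c (i, t) = a (i, t) + 1) (by
      simp only [wBasis_apply]
      exact (quantumMatrix_W h.1 h.one_add_sq_ne).mon_mul_entry i j a)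
  have hcoef : ∀ a a', wCoef h (i, j) a a'
      = (wBasis n h).repr (WPow q a * W q (i, j)) a' := fun a a' => by
    rw [wCoef, wBasis_apply]
  refine ⟨-1 / (q - q⁻¹) * q ^ (-(rightExp i j (i, j)) - X.twist),
    mul_ne_zero (div_ne_zero (neg_ne_zero.mpr one_ne_zero) h.sub_inv_ne) (zpow_ne_zero _ h.1),
    fun a a' ha => ?_, fun a a' hne => ?_⟩
  · obtain rfl := shift_eq_neg_single.mp ha
    rw [coef_partialZ, hcoef, (key a').1, pairNorm_add_single, Pairing.int_succ h.1,
      wt_add, wt_single, wt_add_single]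
    · have e1 : (a' + Pi.single (i, j) 1 : Node n → ℕ) (i, j) = a' (i, j) + 1 := by simp
      have e2 := pairNorm_ne_zero h X a'
      have e3 : q ^ (X.twist * (a' (i, j) : ℤ)) * q ^ wt (rightExp i j) a'
          = q ^ (-(rightExp i j (i, j)) - X.twist) * q ^ (wt (rightExp i j) a'
            + rightExp i j (i, j) + X.twist * ((a' (i, j) + 1 : ℕ) : ℤ)) := by
        rw [← zpow_add₀ h.1, ← zpow_add₀ h.1]
        congr 1
        push_cast
        ring
      simp only [e1]
      rw [mul_assoc, mul_assoc, inv_mul_cancel_left₀ e2]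
      linear_combination (-1 / (q - q⁻¹) * qInt q (a' (i, j) + 1)) * e3
    · rintro ⟨t, ht, h1⟩
      simp [ht.ne'] at h1
  · rw [coef_partialZ, hcoef] at hne
    rcases (key a').2 a (right_ne_zero_of_mul hne) with h1 | ⟨t, ht, h1⟩
    · exact Or.inl (shift_eq_neg_single.mpr h1)
    · exact Or.inr ⟨(i, t), by simpa using ht, by rw [h1]; push_cast; ring⟩

end Derivatives

/-! ### Extraction of the elementary operators -/

section Extraction

variable {n : ℕ} (X : Pairing) (s : Side)

/-- The algebra of differential operators in the bases of ordered monomials. -/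
def diffAlg {q : ℂ} (h : Generic q) : Subalgebra ℂ (Module.End ℂ (APlus n q)) :=
  diffOps q X s (zBasis n h) (wBasis n h)

/-- Some Laurent monomial multiple of `M_p` is a differential operator, uniformly in `q`. -/
def HasM (p : Node n) : Prop :=
  ∃ e : Node n → ℤ, ∀ (q : ℂ) (h : Generic q),
    laurentH q (zBasis n h) e * opM (zBasis n h) p ∈ diffAlg X s h

/-- Some Laurent monomial multiple of `D_p` is a differential operator, uniformly in `q`. -/
def HasD (p : Node n) : Prop :=
  ∃ e : Node n → ℤ, ∀ (q : ℂ) (h : Generic q),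
    laurentH q (zBasis n h) e * opD q (zBasis n h) p ∈ diffAlg X s h

/-- Two Laurent monomials whose quotient is the square of `H_p` are differential operators,
uniformly in `q`. -/
def HasH (p : Node n) : Prop :=
  ∃ e : Node n → ℤ, ∀ (q : ℂ) (h : Generic q),
    laurentH q (zBasis n h) e ∈ diffAlg X s h ∧
      laurentH q (zBasis n h) (e + Pi.single p 2) ∈ diffAlg X s h

variable {X s}

theorem HasM.hasH {p : Node n} (hM : HasM X s p) (hD : HasD X s p) : HasH X s p := by
  obtain ⟨e, he⟩ := hM
  obtain ⟨f, hf⟩ := hD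
  refine ⟨e + f - Pi.single p 1, fun q h => ?_⟩
  exact laurentH_mem (V := APlus n q) (D := diffAlg X s h) (zBasis n h) h.sub_inv_ne h.1
    (he q h) (hf q h)

/-- The unwanted terms of a differential operator can be removed if they are distinguished from
the leading term by the exponents at nodes where Laurent monomials are available. -/
theorem exists_lead {δ : Node n → ℤ} {g : ℂ → (Node n → ℕ) → ℂ} {e : Node n → ℤ} {ε : ℤ}
    (hε : ε ≠ 0) (l : List (Node n)) (hl : ∀ p ∈ l, δ p = 0) (hH : ∀ p ∈ l, HasH X s p)
    (hT : ∀ (q : ℂ) (h : Generic q), ∃ T ∈ diffAlg X s h,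
      HasLead (V := APlus n q) (zBasis n h) q δ (g q) e
        (fun a a' => ∃ p ∈ l, (a' p : ℤ) - a p = ε) T) :
    ∃ e' : Node n → ℤ, ∀ (q : ℂ) (h : Generic q), ∃ T ∈ diffAlg X s h,
      HasLead (V := APlus n q) (zBasis n h) q δ (g q) e' (fun _ _ => False) T := by
  classical
  let f : Node n → Node n → ℤ := fun p => if hp : HasH X s p then hp.choose else 0
  have hf : ∀ p ∈ l, ∀ (q : ℂ) (h : Generic q),
      laurentH q (zBasis n h) (f p) ∈ diffAlg X s h ∧
        laurentH q (zBasis n h) (f p + Pi.single p 2) ∈ diffAlg X s h := by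
    intro p hp q h
    simp only [f, dif_pos (hH p hp)]
    exact (hH p hp).choose_spec q h
  refine ⟨e + (l.map fun p => f p + (f p + Pi.single p 2)).sum, fun q h => ?_⟩
  obtain ⟨T, hTm, hTl⟩ := hT q h
  exact hTl.separate _ h.1 (h.zpow_ne (by omega)) f l hl (fun p hp => (hf p hp q h).1)
    (fun p hp => (hf p hp q h).2) hTm

theorem hasD_of_row {i j : Fin n} (hH : ∀ t > j, HasH X s (i, t)) : HasD X s (i, j) := by
  obtain ⟨e, he⟩ := exists_lead (X := X) (s := s) (δ := -Pi.single (i, j) 1)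
    (g := fun q a => qInt q (a (i, j))) (e := rightExp i j + Pi.single (i, j) X.twist) (ε := -1)
    (by norm_num) (((List.finRange n).filter (j < ·)).map fun t => (i, t))
    (by
      intro p hp
      obtain ⟨t, ht, rfl⟩ := List.mem_map.mp hp
      have : j < t := by simpa using ht
      simp [this.ne'])
    (by
      intro p hp
      obtain ⟨t, ht, rfl⟩ := List.mem_map.mp hp
      exact hH t (by simpa using ht))
    (fun q h => ⟨partialZ X h (i, j),
      Algebra.subset_adjoin (Or.inl ⟨(i, j), isPartial_partialZ X h (i, j)⟩), by
        exact hasLead_partialZ X h i j⟩)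
  refine ⟨e, fun q h => ?_⟩
  obtain ⟨T, hT, hl⟩ := he q h
  exact hl.mem_opD _ h.1 hT

theorem hasM_right {i j : Fin n} (hH : ∀ t > j, HasH X .right (i, t)) : HasM X .right (i, j) := by
  obtain ⟨e, he⟩ := exists_lead (X := X) (s := .right) (δ := Pi.single (i, j) 1)
    (g := fun _ _ => 1) (e := rightExp i j) (ε := 1)
    (by norm_num) (((List.finRange n).filter (j < ·)).map fun t => (i, t))
    (by
      intro p hp
      obtain ⟨t, ht, rfl⟩ := List.mem_map.mp hp
      have : j < t := by simpa using ht
      simp [this.ne'])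
    (by
      intro p hp
      obtain ⟨t, ht, rfl⟩ := List.mem_map.mp hp
      exact hH t (by simpa using ht))
    (fun q h => ⟨_, Algebra.subset_adjoin (Or.inr ⟨(i, j), rfl⟩), hasLead_mulRight h i j⟩)
  refine ⟨e, fun q h => ?_⟩
  obtain ⟨T, hT, hl⟩ := he q h
  exact hl.mem_opM _ h.1 hT

theorem hasM_left {i j : Fin n} (hH : ∀ r < i, HasH X .left (r, j)) : HasM X .left (i, j) := by
  obtain ⟨e, he⟩ := exists_lead (X := X) (s := .left) (δ := Pi.single (i, j) 1)
    (g := fun _ _ => 1) (e := leftExp i j) (ε := 1)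
    (by norm_num) (((List.finRange n).filter (· < i)).map fun r => (r, j))
    (by
      intro p hp
      obtain ⟨r, hr, rfl⟩ := List.mem_map.mp hp
      have : r < i := by simpa using hr
      simp [this.ne])
    (by
      intro p hp
      obtain ⟨r, hr, rfl⟩ := List.mem_map.mp hp
      exact hH r (by simpa using hr))
    (fun q h => ⟨_, Algebra.subset_adjoin (Or.inr ⟨(i, j), rfl⟩), hasLead_mulLeft h i j⟩)
  refine ⟨e, fun q h => ?_⟩
  obtain ⟨T, hT, hl⟩ := he q h
  exact hl.mem_opM _ h.1 hT

/-- With right multiplications, both kinds of operators in a row are found from right to left. -/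
theorem hasM_and_hasD_right (i j : Fin n) : HasM X .right (i, j) ∧ HasD X .right (i, j) := by
  induction j using WellFoundedGT.induction with
  | ind j ih =>
    have hH : ∀ t > j, HasH X .right (i, t) := fun t ht => (ih t ht).1.hasH (ih t ht).2
    exact ⟨hasM_right hH, hasD_of_row hH⟩

/-- With left multiplications, `M_{ij}` is found from the rows above, and then `D_{ij}` from the
columns to the right. -/
theorem hasM_and_hasD_left (i j : Fin n) : HasM X .left (i, j) ∧ HasD X .left (i, j) := by
  induction i using WellFoundedLT.induction generalizing j with
  | ind i ihi =>
    have hM : ∀ j, HasM X .left (i, j) := fun j =>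
      hasM_left fun r hr => (ihi r hr j).1.hasH (ihi r hr j).2
    refine ⟨hM j, ?_⟩
    induction j using WellFoundedGT.induction with
    | ind j ih => exact hasD_of_row fun t ht => (hM t).hasH (ih t ht)

end Extraction

end QuantizedDiffOps

end

open QuantizedDiffOps in
theorem theorem8 (n : ℕ) (X : Pairing) (s : Side) (i j : Fin n) :
    ∃ ψ φ : Node n → ℤ,
      ∀ q : ℂ, q ≠ 0 → (∀ k : ℕ, 0 < k → q ^ k ≠ 1) →
        ∃ (bZ : Module.Basis (Node n → ℕ) ℂ (APlus n q))
          (bW : Module.Basis (Node n → ℕ) ℂ (AMinus n q)),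
          (∀ a, bZ a = ZPow q a) ∧ (∀ a, bW a = WPow q a) ∧
          (∀ p : Node n, ∃ T, IsPartial q X bZ bW p T) ∧
          laurentH q bZ ψ * opM bZ (i, j) ∈ diffOps q X s bZ bW ∧
          laurentH q bZ φ * opD q bZ (i, j) ∈ diffOps q X s bZ bW := by
  obtain ⟨⟨ψ, hψ⟩, φ, hφ⟩ : HasM X s (i, j) ∧ HasD X s (i, j) := by
    cases s with
    | left => exact hasM_and_hasD_left i j
    | right => exact hasM_and_hasD_right i j
  refine ⟨ψ, φ, fun q hq hroot => ?_⟩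
  have h : Generic q := ⟨hq, hroot⟩
  exact ⟨zBasis n h, wBasis n h, zBasis_apply h, wBasis_apply h,
    fun p => ⟨_, isPartial_partialZ X h p⟩, hψ q h, hφ q h⟩
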